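/- Let $\Omega\subset\mathbb{R}^d$ be closed and convex, let $1<p<\infty$, $q>1$, $\alpha>0$, $\beta\in\mathbb{R}$. Let $W_p(\Omega)$ be the space of probability measures concentrated on $\Omega$ with finite $p$-th moment, with the Wasserstein distance of order $p$, and for a measure $\nu$ put $L_q(\nu)=\int u^q\,dx$ if $\nu=u\,\mathcal{L}^d$ and $L_q(\nu)=+\infty$ if $\nu$ has no density. Let $\mu:[0,1]\to W_p(\Omega)$ be a Lipschitz curve. A velocity field of $\mu$ is a Borel field $v:[0,1]\times\Omega\to\mathbb{R}^d$ with $v_t\in L^p(\mu_t)$ for a.e. $t$ such that, for all $\phi\in C^1_c(\mathbb{R}^d)$, the function $s\mapsto\int\nabla\phi\cdot v_s\,d\mu_s$ is integrable on $[0,1]$ and $$\int\phi\,d\mu_{t_2}-\int\phi\,d\mu_{t_1}=\int_{t_1}^{t_2}\int\nabla\phi\cdot v_s\,d\mu_s\,ds\qquad(0\le t_1<t_2\le 1).$$ Let $v$ be the tangent field of $\mu$, i.e. a velocity field such that for every velocity field $w$ one has $\|v_t\|_{L^p(\mu_t)}\le\|w_t\|_{L^p(\mu_t)}$ for a.e.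 $t$. Put $$F(t)=L_q(\mu_t),\qquad V(t)=V(\mu,t)=\int|v_t|^p\,d\mu_t,\qquad \mathfrak{F}(\mu)=\int_0^1F(t)^\alpha V(t)^\beta\,dt .$$ Let $\xi$ be the restriction to $[0,1]\times\mathbb{R}^d$ of a function in $C^\infty_c(\mathbb{R}\times\mathbb{R}^d;\mathbb{R}^d)$, let $T^\varepsilon_t(x)=x+\varepsilon\xi(t,x)$, $\mu^\varepsilon_t=(T^\varepsilon_t)_\sharp\mu_t$, and let $v^\varepsilon$ be the field defined by $$v^\varepsilon_t\,\mu^\varepsilon_t=(T^\varepsilon_t)_\sharp\Big[\Big(\nabla T^\varepsilon_t\cdot v_t+\frac{\partial T^\varepsilon}{\partial t}\Big)\mu_t\Big].$$ Put $$\tilde{\mathfrak{F}}(\mu^\varepsilon)=\int_0^1 L_q(\mu^\varepsilon_t)^\alpha\Big(\int|v^\varepsilon_t|^p\,d\mu^\varepsilon_t\Big)^\beta dt .$$ Suppose that $\mathfrak{F}(\mu)<+\infty$ and that $V(\mu,t)\ge V_0$ for a.e. $t\in[0,1]$, for some constant $V_0>0$. Then for a.e. $t$ the measure $\mu_t$ has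 a density $u_t\in L^q$; $\tilde{\mathfrak{F}}(\mu^\varepsilon)$ is finite for all $\varepsilon$ close to $0$; all the integrals below converge absolutely (the inner ones for a.e. $t$); and $\varepsilon\mapsto\tilde{\mathfrak{F}}(\mu^\varepsilon)$ is differentiable at $\varepsilon=0$ with $$\frac{d}{d\varepsilon}\tilde{\mathfrak{F}}(\mu^\varepsilon)\Big|_{\varepsilon=0}=\alpha(1-q)\int_0^1F^{\alpha-1}V^{\beta}\int_\Omega(\nabla\cdot\xi)\,u_t^q\,dx\,dt+p\beta\int_0^1F^{\alpha}V^{\beta-1}\int_\Omega|v_t|^{p-2}\Big(\nabla\xi\cdot v_t+\frac{\partial\xi}{\partial t}\Big)\cdot v_t\,d\mu_t\,dt$$ (the integrand $|v|^{p-2}(\cdots)\cdot v$ is read as $0$ where $v=0$). -/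

import Mathlib

open Set Filter Topology MeasureTheory
open scoped NNReal ENNReal ContDiff

/-- The Euclidean space `ℝ^d`. -/
abbrev EucSp (d : ℕ) : Type := EuclideanSpace ℝ (Fin d)

namespace WeightedGeodesic

variable {d : ℕ}

/-- The transport plans between two measures. -/
def couplings (μ ν : Measure (EucSp d)) : Set (Measure (EucSp d × EucSp d)) :=
  {π | π.map Prod.fst = μ ∧ π.map Prod.snd = ν}

/-- The Wasserstein distance of order `p`. -/
noncomputable def wassersteinDist (p : ℝ) (μ ν : Measure (EucSp d)) : ℝ≥0∞ :=
  (⨅ π ∈ couplings μ ν, ∫⁻ z, edist z.1 z.2 ^ p ∂π) ^ (1 / p)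

/-- `W_p(Ω)`: the probability measures concentrated on `Ω` with finite `p`-th moment, seen as
measures on `ℝ^d`. -/
structure MemWassersteinSpace (p : ℝ) (Ω : Set (EucSp d)) (μ : Measure (EucSp d)) : Prop where
  isProbabilityMeasure : IsProbabilityMeasure μ
  compl_eq_zero : μ Ωᶜ = 0
  moment_ne_top : ∫⁻ x, ‖x‖ₑ ^ p ∂μ ≠ ⊤

/-- Lipschitz curves `[0,1] → W_p(Ω)`; only the values at times in `[0,1]` matter. -/
structure IsLipschitzCurve (p : ℝ) (Ω : Set (EucSp d)) (μ : ℝ → Measure (EucSp d)) : Prop where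
  mem : ∀ t ∈ Icc (0 : ℝ) 1, MemWassersteinSpace p Ω (μ t)
  lipschitz : ∃ K : ℝ≥0, ∀ s ∈ Icc (0 : ℝ) 1, ∀ t ∈ Icc (0 : ℝ) 1,
    wassersteinDist p (μ s) (μ t) ≤ K * edist s t

/-- `v` is a velocity field of the curve `μ`: a Borel vector field on `[0,1] × Ω` with
`v_t ∈ L^p(μ_t)` for a.e. `t`, satisfying the continuity equation `∂ₜ μ + ∇ ⬝ (v μ) = 0`.
The test functions are the restrictions to the closed set `Ω` of `C^1_c(ℝ^d)` functions (they need
not vanish on `∂Ω`: there is no flux through the boundary). -/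
structure IsVelocityField (p : ℝ) (Ω : Set (EucSp d)) (μ : ℝ → Measure (EucSp d))
    (v : ℝ → EucSp d → EucSp d) : Prop where
  measurable : Measurable ((Icc (0 : ℝ) 1 ×ˢ Ω).domRestrict (Function.uncurry v))
  memLp : ∀ᵐ t ∂volume.restrict (Icc (0 : ℝ) 1), MemLp (v t) (ENNReal.ofReal p) (μ t)
  integrable : ∀ φ : EucSp d → ℝ, ContDiff ℝ 1 φ → HasCompactSupport φ →
    IntegrableOn (fun s => ∫ x, fderiv ℝ φ x (v s x) ∂μ s) (Icc (0 : ℝ) 1)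
  continuity_eq : ∀ φ : EucSp d → ℝ, ContDiff ℝ 1 φ → HasCompactSupport φ →
    ∀ t₁ ∈ Icc (0 : ℝ) 1, ∀ t₂ ∈ Icc (0 : ℝ) 1, t₁ < t₂ →
      ∫ x, φ x ∂μ t₂ - ∫ x, φ x ∂μ t₁ = ∫ s in t₁..t₂, ∫ x, fderiv ℝ φ x (v s x) ∂μ s

/-- `v` is the tangent field of `μ`: among all velocity fields, `v_t` has minimal `L^p(μ_t)` norm
for a.e. `t`. -/
structure IsTangentField (p : ℝ) (Ω : Set (EucSp d)) (μ : ℝ → Measure (EucSp d))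
    (v : ℝ → EucSp d → EucSp d) : Prop where
  isVelocityField : IsVelocityField p Ω μ v
  minimal : ∀ w, IsVelocityField p Ω μ w → ∀ᵐ t ∂volume.restrict (Icc (0 : ℝ) 1),
    eLpNorm (v t) (ENNReal.ofReal p) (μ t) ≤ eLpNorm (w t) (ENNReal.ofReal p) (μ t)

open Classical in
/-- `L_q(ν) = ∫ u^q` if `ν = u 𝓛^d`, and `+∞` if `ν` has no density. For `ν` concentrated on `Ω`
the density vanishes a.e. outside `Ω`, so the integral is the one over `Ω`. -/
noncomputable def Lq (q : ℝ) (ν : Measure (EucSp d)) : ℝ≥0∞ :=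
  if ν ≪ volume then ∫⁻ x, ν.rnDeriv volume x ^ q else ⊤

/-- `∫ |v_t|^p dμ_t`; this is `V(μ,t)` when `v` is the tangent field of `μ`. -/
noncomputable def kinetic (p : ℝ) (μ : ℝ → Measure (EucSp d)) (v : ℝ → EucSp d → EucSp d)
    (t : ℝ) : ℝ≥0∞ :=
  ∫⁻ x, ‖v t x‖ₑ ^ p ∂μ t

/-- `∫₀¹ L_q(μ_t)^α (∫ |v_t|^p dμ_t)^β dt`; this is `𝔉(μ)` when `v` is the tangent field of `μ`. -/
noncomputable def energy (p q α β : ℝ) (μ : ℝ → Measure (EucSp d)) (v : ℝ → EucSp d → EucSp d) :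
    ℝ≥0∞ :=
  ∫⁻ t in Icc (0 : ℝ) 1, Lq q (μ t) ^ α * kinetic p μ v t ^ β

/-- The curve `(T_t)_♯ μ_t`. -/
noncomputable def pushCurve (T : ℝ → EucSp d → EucSp d) (μ : ℝ → Measure (EucSp d)) :
    ℝ → Measure (EucSp d) :=
  fun t => (μ t).map (T t)

/-- The vector field `∇T_t ⬝ v_t + ∂T/∂t`. -/
noncomputable def lagrangianField (T v : ℝ → EucSp d → EucSp d) : ℝ → EucSp d → EucSp d :=
  fun t x => fderiv ℝ (T t) x (v t x) + deriv (fun s => T s x) t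

/-- The vector field `v'` on the curve `μ'_t = (T_t)_♯ μ_t` defined by
`v'_t ⬝ μ'_t = (T_t)_♯ [(∇T_t ⬝ v_t + ∂T/∂t) μ_t]`, that is, the Radon-Nikodym density
(component by component) of the right-hand side with respect to `μ'_t`. -/
noncomputable def transportedField (T : ℝ → EucSp d → EucSp d) (μ : ℝ → Measure (EucSp d))
    (v : ℝ → EucSp d → EucSp d) : ℝ → EucSp d → EucSp d :=
  fun t y => WithLp.toLp 2 fun i =>
    SignedMeasure.rnDeriv (((μ t).withDensityᵥ fun x => lagrangianField T v t x i).map (T t))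
      (pushCurve T μ t) y

/-- The map `T^ε(t,x) = x + ε ξ(t,x)`. -/
def perturb (ξ : ℝ → EucSp d → EucSp d) (ε : ℝ) : ℝ → EucSp d → EucSp d :=
  fun t x => x + ε • ξ t x

/-- The modified functional `𝔉̃(μ^ε) = ∫₀¹ L_q(μ^ε_t)^α (∫ |v^ε_t|^p dμ^ε_t)^β dt`, where
`μ^ε_t = (id + ε ξ(t,·))_♯ μ_t` and `v^ε` is the field transported from the field `v` of `μ`. -/
noncomputable def modifiedEnergy (p q α β : ℝ) (μ : ℝ → Measure (EucSp d))
    (v ξ : ℝ → EucSp d → EucSp d) (ε : ℝ) : ℝ≥0∞ :=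
  energy p q α β (pushCurve (perturb ξ ε) μ) (transportedField (perturb ξ ε) μ v)

/-- The divergence of a vector field on `ℝ^d`. -/
noncomputable def divergence (f : EucSp d → EucSp d) (x : EucSp d) : ℝ :=
  ∑ i, fderiv ℝ f x (EuclideanSpace.single i 1) i

/-- The integrand `(∇ ⬝ ξ_t) u_t^q`, where `u_t` is the density of `μ_t`. -/
noncomputable def pressureDensity (q : ℝ) (μ : ℝ → Measure (EucSp d)) (ξ : ℝ → EucSp d → EucSp d)
    (t : ℝ) (x : EucSp d) : ℝ :=
  divergence (ξ t) x * ((μ t).rnDeriv volume x).toReal ^ q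

/-- The integrand `|v_t|^{p-2} (∇ξ ⬝ v_t + ∂ξ/∂t) ⬝ v_t`. -/
noncomputable def kineticDensity (p : ℝ) (v ξ : ℝ → EucSp d → EucSp d) (t : ℝ) (x : EucSp d) : ℝ :=
  ‖v t x‖ ^ (p - 2) * inner ℝ (lagrangianField ξ v t x) (v t x)

end WeightedGeodesic

/-!
For a.e. `t`, both factors of the integrand depend on `ε` with a relative error of order `ε` which
is uniform in `t`. Indeed, the change of variables along the homeomorphism `id + ε ξ_t` gives
`L_q(μ^ε_t) = ∫ u_t^q |det (1 + ε ∇ξ_t)|^{1-q} dx`, and since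
`v^ε_t ∘ T^ε_t = ∇T^ε_t ⬝ v_t + ∂T^ε/∂t`, the kinetic factor is
`∫ |v_t + ε (∇ξ ⬝ v_t + ∂ξ/∂t)|^p dμ_t`. The part of this error which comes from `∂ξ/∂t` is not
controlled by `|v_t|`, but it is bounded, hence at most a constant times `V₀⁻¹ V(t)`. The difference
quotients of the integrand are therefore dominated by a multiple of `F^α V^β`, which is integrable,
and dominated convergence applies.
-/

namespace WeightedGeodesic

section ParametricIntegral

variable {X 𝕜 E : Type*} [MeasurableSpace X] {m : Measure X} [RCLike 𝕜]
  [NormedAddCommGroup E] [NormedSpace 𝕜 E] {f : 𝕜 → X → E} {f' : X → E} {bound : X → ℝ} {ε₀ : 𝕜}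

theorem aestronglyMeasurable_of_hasDerivAt
    (hmeas : ∀ᶠ ε in 𝓝 ε₀, AEStronglyMeasurable (f ε) m)
    (hderiv : ∀ᵐ x ∂m, HasDerivAt (f · x) (f' x) ε₀) : AEStronglyMeasurable f' m := by
  obtain ⟨s, hs, hsmeas⟩ := exists_seq_forall_of_frequently
    (hmeas.filter_mono (nhdsWithin_le_nhds (s := {ε₀}ᶜ))).frequently
  refine aestronglyMeasurable_of_tendsto_ae atTop (f := fun n x => slope (f · x) ε₀ (s n))
    (fun n => ((hsmeas n).sub hmeas.self_of_nhds).const_smul (s n - ε₀)⁻¹) ?_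
  filter_upwards [hderiv] with x hx
  exact (hasDerivAt_iff_tendsto_slope.1 hx).comp hs

theorem ae_norm_le_of_hasDerivAt (hbound₀ : ∀ᵐ x ∂m, 0 ≤ bound x)
    (hbound : ∀ᶠ z in 𝓝 ε₀ ×ˢ ae m, ‖f z.1 z.2 - f ε₀ z.2‖ ≤ bound z.2 * ‖z.1 - ε₀‖)
    (hderiv : ∀ᵐ x ∂m, HasDerivAt (f · x) (f' x) ε₀) : ∀ᵐ x ∂m, ‖f' x‖ ≤ bound x := by
  filter_upwards [hbound₀, hderiv, (eventually_swap_iff.1 hbound).curry] with x h₀ hx hle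
  exact hx.le_of_lip' h₀ hle

variable [NormedSpace ℝ E]

theorem hasDerivAt_integral_of_norm_sub_le
    (hmeas : ∀ᶠ ε in 𝓝 ε₀, AEStronglyMeasurable (f ε) m) (hint : Integrable (f ε₀) m)
    (hbound : ∀ᶠ z in 𝓝 ε₀ ×ˢ ae m, ‖f z.1 z.2 - f ε₀ z.2‖ ≤ bound z.2 * ‖z.1 - ε₀‖)
    (hbound_int : Integrable bound m) (hderiv : ∀ᵐ x ∂m, HasDerivAt (f · x) (f' x) ε₀) :
    Integrable f' m ∧ HasDerivAt (fun ε => ∫ x, f ε x ∂m) (∫ x, f' x ∂m) ε₀ := by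
  let L : E →L[𝕜] 𝕜 →L[𝕜] E := ContinuousLinearMap.smulRightL 𝕜 𝕜 E 1
  have hf'_meas := aestronglyMeasurable_of_hasDerivAt hmeas hderiv
  have hLf'_meas : AEStronglyMeasurable (L ∘ f') m :=
    L.continuous.comp_aestronglyMeasurable hf'_meas
  obtain ⟨P, hP, Q, hQ, hPQ⟩ := eventually_prod_iff.1 hbound
  obtain ⟨hLf'_int, key⟩ := hasFDerivAt_integral_of_dominated_loc_of_lip' (hP.and hmeas)
    (fun ε hε => hε.2) hint hLf'_meas (hQ.mono fun x hx ε hε => hPQ hε.1 hx) hbound_int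
    (hderiv.mono fun x hx => hx.hasFDerivAt)
  have hf'_int : Integrable f' m := by
    rw [← integrable_norm_iff hLf'_meas] at hLf'_int
    simpa [L, Function.comp_def, integrable_norm_iff hf'_meas] using! hLf'_int
  refine ⟨hf'_int, ?_⟩
  by_cases hE : CompleteSpace E
  · simpa only [hasDerivAt_iff_hasFDerivAt, Function.comp_def,
      ContinuousLinearMap.integral_comp_comm _ hf'_int] using! key
  · simpa [integral, hE] using! hasDerivAt_const ε₀ 0

end ParametricIntegral

section RelativePerturbation

open Asymptotics

variable {X : Type*} [MeasurableSpace X] {m : Measure X} {f g : ℝ → X → ℝ} {f' g' : X → ℝ}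

/-- The positive function `f 0` is perturbed to `f ε` with a relative error that is `O(ε)` uniformly
a.e., and with a.e. derivative `f'` at `ε = 0`. This is stable under products and real powers, and
allows differentiation under the integral as soon as `f 0` is integrable. -/
structure HasRelBoundedDeriv (m : Measure X) (f : ℝ → X → ℝ) (f' : X → ℝ) : Prop where
  aemeasurable : ∀ᶠ ε in 𝓝 0, AEMeasurable (f ε) m
  pos : ∀ᵐ x ∂m, 0 < f 0 x
  isBigO : (fun z : ℝ × X => f z.1 z.2 - f 0 z.2) =O[𝓝 0 ×ˢ ae m] fun z => z.1 * f 0 z.2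
  hasDerivAt : ∀ᵐ x ∂m, HasDerivAt (f · x) (f' x) 0

namespace HasRelBoundedDeriv

theorem isBigO_div_sub_one (hf : HasRelBoundedDeriv m f f') :
    (fun z : ℝ × X => f z.1 z.2 / f 0 z.2 - 1) =O[𝓝 0 ×ˢ ae m] Prod.fst := by
  refine (hf.isBigO.mul (isBigO_refl (fun z : ℝ × X => (f 0 z.2)⁻¹) _)).congr' ?_ ?_ <;>
    filter_upwards [hf.pos.prod_inr (𝓝 (0 : ℝ))] with z hz
  · field_simp
  · field_simp

theorem tendsto_div (hf : HasRelBoundedDeriv m f f') :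
    Tendsto (fun z : ℝ × X => f z.1 z.2 / f 0 z.2) (𝓝 0 ×ˢ ae m) (𝓝 1) := by
  simpa using (hf.isBigO_div_sub_one.trans_tendsto tendsto_fst).add_const 1

theorem isBigO_self (hf : HasRelBoundedDeriv m f f') :
    (fun z : ℝ × X => f z.1 z.2) =O[𝓝 0 ×ˢ ae m] fun z => f 0 z.2 := by
  refine ((hf.tendsto_div.isBigO_one ℝ).mul (isBigO_refl (fun z : ℝ × X => f 0 z.2) _)).congr' ?_
    (by simp)
  filter_upwards [hf.pos.prod_inr (𝓝 (0 : ℝ))] with z hz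
  field_simp

theorem eventually_pos (hf : HasRelBoundedDeriv m f f') :
    ∀ᶠ z in 𝓝 0 ×ˢ ae m, 0 < f z.1 z.2 := by
  filter_upwards [hf.tendsto_div.eventually_const_lt one_pos, hf.pos.prod_inr (𝓝 (0 : ℝ))]
    with z hz hz₀
  exact (div_pos_iff_of_pos_right hz₀).1 hz

theorem mul (hf : HasRelBoundedDeriv m f f') (hg : HasRelBoundedDeriv m g g') :
    HasRelBoundedDeriv m (fun ε x => f ε x * g ε x) fun x => f' x * g 0 x + f 0 x * g' x where
  aemeasurable := by filter_upwards [hf.aemeasurable, hg.aemeasurable] with ε h₁ h₂ using h₁.mul h₂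
  pos := by filter_upwards [hf.pos, hg.pos] with x h₁ h₂ using mul_pos h₁ h₂
  isBigO := by
    have hf₀ := isBigO_refl (fun z : ℝ × X => f 0 z.2) (𝓝 0 ×ˢ ae m)
    refine (((hf.isBigO.mul hg.isBigO_self).congr_right fun z => ?_).add
      ((hf₀.mul hg.isBigO).congr_right fun z => ?_)).congr_left fun z => ?_
    · exact mul_assoc _ _ _
    · exact mul_left_comm _ _ _
    · ring
  hasDerivAt := by filter_upwards [hf.hasDerivAt, hg.hasDerivAt] with x h₁ h₂ using h₁.mul h₂

theorem rpow_const (hf : HasRelBoundedDeriv m f f') (a : ℝ) :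
    HasRelBoundedDeriv m (fun ε x => f ε x ^ a) fun x => f' x * a * f 0 x ^ (a - 1) where
  aemeasurable := by filter_upwards [hf.aemeasurable] with ε h using h.pow_const a
  pos := by filter_upwards [hf.pos] with x h using Real.rpow_pos_of_pos h a
  isBigO := by
    have hpow : (fun s : ℝ => s ^ a - 1) =O[𝓝 1] fun s => s - 1 := by
      simpa using (Real.hasDerivAt_rpow_const (p := a) (Or.inl one_ne_zero)).isBigO_sub
    refine (((hpow.comp_tendsto hf.tendsto_div).trans hf.isBigO_div_sub_one).mul
      (isBigO_refl (fun z : ℝ × X => f 0 z.2 ^ a) _)).congr' ?_ EventuallyEq.rfl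
    filter_upwards [hf.eventually_pos, hf.pos.prod_inr (𝓝 (0 : ℝ))] with z hz hz₀
    have : f 0 z.2 ^ a ≠ 0 := (Real.rpow_pos_of_pos hz₀ a).ne'
    simp only [Function.comp_apply, Real.div_rpow hz.le hz₀.le]
    field_simp
  hasDerivAt := by
    filter_upwards [hf.hasDerivAt, hf.pos] with x h hx using h.rpow_const (Or.inl hx.ne')

theorem aemeasurable_deriv (hf : HasRelBoundedDeriv m f f') : AEMeasurable f' m :=
  (aestronglyMeasurable_of_hasDerivAt
    (hf.aemeasurable.mono fun _ h => h.aestronglyMeasurable) hf.hasDerivAt).aemeasurable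

theorem exists_bound (hf : HasRelBoundedDeriv m f f') :
    ∃ C ≥ 0, ∀ᶠ z in 𝓝 0 ×ˢ ae m, ‖f z.1 z.2 - f 0 z.2‖ ≤ C * f 0 z.2 * ‖z.1 - 0‖ := by
  obtain ⟨C, hC, hle⟩ := hf.isBigO.exists_nonneg
  refine ⟨C, hC, ?_⟩
  filter_upwards [hle.bound, hf.pos.prod_inr (𝓝 (0 : ℝ))] with z hz hz₀
  calc _ ≤ C * ‖z.1 * f 0 z.2‖ := hz
    _ = C * f 0 z.2 * ‖z.1 - 0‖ := by
      rw [norm_mul, Real.norm_of_nonneg hz₀.le, sub_zero]; ring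

theorem exists_norm_deriv_le (hf : HasRelBoundedDeriv m f f') :
    ∃ C, ∀ᵐ x ∂m, ‖f' x‖ ≤ C * f 0 x := by
  obtain ⟨C, hC, hle⟩ := hf.exists_bound
  have hbound : ∀ᵐ x ∂m, 0 ≤ C * f 0 x := hf.pos.mono fun x hx => mul_nonneg hC hx.le
  exact ⟨C, ae_norm_le_of_hasDerivAt hbound hle hf.hasDerivAt⟩

theorem eventually_integrable (hf : HasRelBoundedDeriv m f f') (hint : Integrable (f 0) m) :
    ∀ᶠ ε in 𝓝 0, Integrable (f ε) m := by
  obtain ⟨C, hle⟩ := hf.isBigO_self.bound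
  filter_upwards [hle.curry, hf.aemeasurable] with ε hε hmeas
  exact (hint.norm.const_mul C).mono' hmeas.aestronglyMeasurable hε

theorem hasDerivAt_integral (hf : HasRelBoundedDeriv m f f') (hint : Integrable (f 0) m) :
    HasDerivAt (fun ε => ∫ x, f ε x ∂m) (∫ x, f' x ∂m) 0 := by
  obtain ⟨C, -, hle⟩ := hf.exists_bound
  exact (hasDerivAt_integral_of_norm_sub_le
    (hf.aemeasurable.mono fun _ h => h.aestronglyMeasurable) hint hle (hint.const_mul C)
    hf.hasDerivAt).2

theorem integrable_rpow_sub_one_mul {W P : X → ℝ} {a c : ℝ} (hc : c ≠ 0)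
    (hf : HasRelBoundedDeriv m f fun x => c * P x)
    (hint : Integrable (fun x => f 0 x ^ a * W x) m) :
    Integrable (fun x => f 0 x ^ (a - 1) * W x * P x) m := by
  obtain ⟨C, hC⟩ := hf.exists_norm_deriv_le
  have hbdd : ∀ᵐ x ∂m, ‖c * P x / f 0 x‖ ≤ C := by
    filter_upwards [hf.pos, hC] with x hpos hle
    rwa [norm_div, Real.norm_of_nonneg hpos.le, div_le_iff₀ hpos]
  refine ((hint.mul_bdd (hf.aemeasurable_deriv.div hf.aemeasurable.self_of_nhds
    ).aestronglyMeasurable hbdd).const_mul c⁻¹).congr ?_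
  filter_upwards [hf.pos] with x hpos
  rw [Pi.div_apply, Real.rpow_sub_one hpos.ne']
  field_simp

end HasRelBoundedDeriv

section Lintegral

variable {G L K : ℝ → X → ℝ≥0∞} {g' P Q : X → ℝ} {a b α β : ℝ}

namespace HasRelBoundedDeriv

theorem eventually_lintegral_eq_ofReal_toReal
    (hG : HasRelBoundedDeriv m (fun ε x => (G ε x).toReal) g') :
    ∀ᶠ ε in 𝓝 0, ∫⁻ x, G ε x ∂m = ∫⁻ x, ENNReal.ofReal (G ε x).toReal ∂m := by
  filter_upwards [hG.eventually_pos.curry] with ε hε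
  refine lintegral_congr_ae ?_
  filter_upwards [hε] with x hx
  exact (ENNReal.ofReal_toReal (ENNReal.toReal_pos_iff.1 hx).2.ne).symm

theorem integrable_toReal (hG : HasRelBoundedDeriv m (fun ε x => (G ε x).toReal) g')
    (hfin : ∫⁻ x, G 0 x ∂m < ⊤) : Integrable (fun x => (G 0 x).toReal) m := by
  rw [hG.eventually_lintegral_eq_ofReal_toReal.self_of_nhds] at hfin
  exact (lintegral_ofReal_ne_top_iff_integrable hG.aemeasurable.self_of_nhds.aestronglyMeasurable
    (ae_of_all _ fun _ => ENNReal.toReal_nonneg)).1 hfin.ne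

theorem eventually_lintegral_eq (hG : HasRelBoundedDeriv m (fun ε x => (G ε x).toReal) g')
    (hfin : ∫⁻ x, G 0 x ∂m < ⊤) :
    ∀ᶠ ε in 𝓝 0, ∫⁻ x, G ε x ∂m = ENNReal.ofReal (∫ x, (G ε x).toReal ∂m) := by
  filter_upwards [hG.eventually_lintegral_eq_ofReal_toReal,
    hG.eventually_integrable (hG.integrable_toReal hfin)] with ε hε hint
  rw [hε, ofReal_integral_eq_lintegral_ofReal hint (ae_of_all _ fun _ => ENNReal.toReal_nonneg)]

theorem hasDerivAt_toReal_lintegral (hG : HasRelBoundedDeriv m (fun ε x => (G ε x).toReal) g')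
    (hfin : ∫⁻ x, G 0 x ∂m < ⊤) :
    HasDerivAt (fun ε => (∫⁻ x, G ε x ∂m).toReal) (∫ x, g' x ∂m) 0 := by
  refine (hG.hasDerivAt_integral (hG.integrable_toReal hfin)).congr_of_eventuallyEq ?_
  filter_upwards [hG.eventually_lintegral_eq hfin] with ε hε
  rw [hε, ENNReal.toReal_ofReal (integral_nonneg fun _ => ENNReal.toReal_nonneg)]

theorem toReal_rpow_mul_rpow
    (hL : HasRelBoundedDeriv m (fun ε x => (L ε x).toReal) fun x => a * P x)
    (hK : HasRelBoundedDeriv m (fun ε x => (K ε x).toReal) fun x => b * Q x) :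
    HasRelBoundedDeriv m (fun ε x => (L ε x ^ α * K ε x ^ β).toReal) fun x =>
      α * a * ((L 0 x).toReal ^ (α - 1) * (K 0 x).toReal ^ β * P x) +
        b * β * ((L 0 x).toReal ^ α * (K 0 x).toReal ^ (β - 1) * Q x) := by
  simp only [ENNReal.toReal_mul, ← ENNReal.toReal_rpow]
  convert (hL.rpow_const α).mul (hK.rpow_const β) using 2
  ring

theorem integrable_toReal_rpow_mul_rpow_sub_one (ha : a ≠ 0) (hb : b ≠ 0)
    (hL : HasRelBoundedDeriv m (fun ε x => (L ε x).toReal) fun x => a * P x)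
    (hK : HasRelBoundedDeriv m (fun ε x => (K ε x).toReal) fun x => b * Q x)
    (hfin : ∫⁻ x, L 0 x ^ α * K 0 x ^ β ∂m < ⊤) :
    Integrable (fun x => (L 0 x).toReal ^ (α - 1) * (K 0 x).toReal ^ β * P x) m ∧
      Integrable (fun x => (L 0 x).toReal ^ α * (K 0 x).toReal ^ (β - 1) * Q x) m := by
  have hint := (hL.toReal_rpow_mul_rpow hK).integrable_toReal hfin
  simp only [ENNReal.toReal_mul, ← ENNReal.toReal_rpow] at hint
  refine ⟨hL.integrable_rpow_sub_one_mul ha hint, ?_⟩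
  have hint' : Integrable (fun x => (K 0 x).toReal ^ β * (L 0 x).toReal ^ α) m := by
    simpa only [mul_comm] using hint
  simpa only [mul_comm ((K 0 _).toReal ^ (β - 1))] using hK.integrable_rpow_sub_one_mul hb hint'

theorem hasDerivAt_toReal_lintegral_rpow_mul_rpow (ha : a ≠ 0) (hb : b ≠ 0)
    (hL : HasRelBoundedDeriv m (fun ε x => (L ε x).toReal) fun x => a * P x)
    (hK : HasRelBoundedDeriv m (fun ε x => (K ε x).toReal) fun x => b * Q x)
    (hfin : ∫⁻ x, L 0 x ^ α * K 0 x ^ β ∂m < ⊤) :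
    HasDerivAt (fun ε => (∫⁻ x, L ε x ^ α * K ε x ^ β ∂m).toReal)
      (α * a * ∫ x, (L 0 x).toReal ^ (α - 1) * (K 0 x).toReal ^ β * P x ∂m +
        b * β * ∫ x, (L 0 x).toReal ^ α * (K 0 x).toReal ^ (β - 1) * Q x ∂m) 0 := by
  obtain ⟨hintL, hintK⟩ := integrable_toReal_rpow_mul_rpow_sub_one ha hb hL hK hfin
  rw [← integral_const_mul, ← integral_const_mul,
    ← integral_add (hintL.const_mul _) (hintK.const_mul _)]
  exact (hL.toReal_rpow_mul_rpow hK).hasDerivAt_toReal_lintegral hfin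

end HasRelBoundedDeriv

end Lintegral

end RelativePerturbation

section Jacobian

open Module

variable {E : Type*} [NormedAddCommGroup E] [NormedSpace ℝ E]

theorem eventually_forall_smul_of_norm_le {P : E → Prop} (hP : ∀ᶠ x in 𝓝 0, P x) (K : ℝ) :
    ∀ᶠ ε in 𝓝 (0 : ℝ), ∀ x, ‖x‖ ≤ K → P (ε • x) := by
  obtain ⟨r, hr, hball⟩ := Metric.eventually_nhds_iff.1 hP
  have hlim : Tendsto (fun ε : ℝ => ‖ε‖ * K) (𝓝 0) (𝓝 0) := by
    simpa using (tendsto_norm_zero (E := ℝ)).mul_const K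
  filter_upwards [hlim.eventually_lt_const hr] with ε hε x hx
  refine hball ?_
  rw [dist_zero_right, norm_smul]
  exact (mul_le_mul_of_nonneg_left hx (norm_nonneg ε)).trans_lt hε

/-- The factor `|det (1 + B)| ^ (1 - q)` by which the integrand `u ^ q` of `L_q` is multiplied under
a map with differential `1 + B`. -/
noncomputable def jacobianPow (q : ℝ) (B : E →L[ℝ] E) : ℝ :=
  |(1 + B).det| ^ (1 - q)

theorem jacobianPow_zero (q : ℝ) : jacobianPow q (0 : E →L[ℝ] E) = 1 := by
  simp [jacobianPow, ContinuousLinearMap.det]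

theorem jacobianPow_nonneg (q : ℝ) (B : E →L[ℝ] E) : 0 ≤ jacobianPow q B :=
  Real.rpow_nonneg (abs_nonneg _) _

theorem measurable_jacobianPow (q : ℝ) : Measurable (jacobianPow q : (E →L[ℝ] E) → ℝ) :=
  (ContinuousLinearMap.continuous_det.comp
    (continuous_const.add continuous_id)).measurable.abs.pow_const _

theorem jacobianPow_eventuallyEq (q : ℝ) :
    jacobianPow q =ᶠ[𝓝 (0 : E →L[ℝ] E)] fun B => (1 + B).det ^ (1 - q) := by
  have hcont : ContinuousAt (fun B : E →L[ℝ] E => (1 + B).det) 0 :=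
    (ContinuousLinearMap.continuous_det.comp (continuous_const.add continuous_id)).continuousAt
  filter_upwards [hcont.eventually_const_lt (u := 0) (by simp [ContinuousLinearMap.det])] with B hB
  rw [jacobianPow, abs_of_pos hB]

theorem integrable_mul_jacobianPow {X : Type*} [MeasurableSpace X] {m : Measure X} {f : X → ℝ}
    {A : X → E →L[ℝ] E} {q C : ℝ} (hf : Integrable f m) (hA : Measurable A)
    (hC : ∀ x, |jacobianPow q (A x) - 1| ≤ C) :
    Integrable (fun x => f x * jacobianPow q (A x)) m := by
  refine hf.mul_bdd (c := C + 1) ((measurable_jacobianPow q).comp hA).aestronglyMeasurable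
    (ae_of_all _ fun x => ?_)
  calc ‖jacobianPow q (A x)‖ ≤ ‖jacobianPow q (A x) - 1‖ + ‖(1 : ℝ)‖ := norm_le_norm_sub_add _ _
    _ ≤ C + 1 := by rw [norm_one]; exact add_le_add_left (hC x) 1

variable [FiniteDimensional ℝ E]

theorem contDiff_det {n : WithTop ℕ∞} :
    ContDiff ℝ n (ContinuousLinearMap.det : (E →L[ℝ] E) → ℝ) := by
  let b := finBasis ℝ E
  have hdet (B : E →L[ℝ] E) : B.det = ∑ σ : Equiv.Perm (Fin (finrank ℝ E)),
      ((Equiv.Perm.sign σ : ℤ) : ℝ) * ∏ i, b.equivFunL (B (b i)) (σ i) := by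
    rw [ContinuousLinearMap.det, ← LinearMap.det_toMatrix b, Matrix.det_apply']
    simp [LinearMap.toMatrix_apply]
  rw [funext hdet]
  fun_prop

theorem det_one_add_ne_zero {B : E →L[ℝ] E} (hB : ‖B‖ < 1) : (1 + B).det ≠ 0 := by
  have := FiniteDimensional.complete ℝ E
  have hunit : IsUnit (1 + B) := by
    simpa using isUnit_one_sub_of_norm_lt_one (x := -B) (by simpa using hB)
  exact (LinearMap.isUnit_det _ (hunit.map ContinuousLinearMap.toLinearMapRingHom)).ne_zero

theorem hasDerivAt_det_one_add_smul (A : E →L[ℝ] E) :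
    HasDerivAt (fun ε : ℝ => (1 + ε • A).det) (LinearMap.trace ℝ E A) 0 := by
  let b := finBasis ℝ E
  let M := LinearMap.toMatrix b b (A : E →ₗ[ℝ] E)
  let R := ((1 : Matrix _ _ (Polynomial ℝ)) +
    (Polynomial.X : Polynomial ℝ) • M.map Polynomial.C).det.divX.divX
  have hdet (ε : ℝ) : (1 + ε • A).det = 1 + M.trace * ε + R.eval ε * ε ^ 2 := by
    rw [← Matrix.det_one_add_smul, ContinuousLinearMap.det, ← LinearMap.det_toMatrix b]
    congr 1
    simp [M, Module.End.one_eq_id]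
  simp_rw [hdet, LinearMap.trace_eq_matrix_trace ℝ b]
  convert! (((hasDerivAt_id (0 : ℝ)).const_mul M.trace).const_add 1).add
    ((R.hasDerivAt 0).mul (hasDerivAt_pow 2 (0 : ℝ))) using 1
  simp [M]

variable (q : ℝ)

theorem hasDerivAt_jacobianPow_smul (A : E →L[ℝ] E) :
    HasDerivAt (fun ε : ℝ => jacobianPow q (ε • A)) ((1 - q) * LinearMap.trace ℝ E A) 0 := by
  have hlim : Tendsto (fun ε : ℝ => ε • A) (𝓝 0) (𝓝 0) := by
    simpa using (tendsto_id (x := 𝓝 (0 : ℝ))).smul_const A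
  refine HasDerivAt.congr_of_eventuallyEq ?_ (hlim.eventually (jacobianPow_eventuallyEq q))
  convert! (hasDerivAt_det_one_add_smul A).rpow_const (p := 1 - q) (Or.inl ?_) using 1
  · simp [ContinuousLinearMap.det, mul_comm]
  · simp [ContinuousLinearMap.det]

theorem exists_abs_jacobianPow_smul_sub_one_le (K : ℝ) :
    ∃ C, ∀ᶠ ε in 𝓝 (0 : ℝ), ∀ A : E →L[ℝ] E, ‖A‖ ≤ K → |jacobianPow q (ε • A) - 1| ≤ C * |ε| := by
  have hdiff : DifferentiableAt ℝ (jacobianPow q : (E →L[ℝ] E) → ℝ) 0 := by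
    refine DifferentiableAt.congr_of_eventuallyEq ?_ (jacobianPow_eventuallyEq q)
    refine DifferentiableAt.rpow_const ?_ (Or.inl (by simp [ContinuousLinearMap.det]))
    exact ((contDiff_det.differentiable one_ne_zero).comp
      ((differentiable_const 1).add differentiable_id)) 0
  obtain ⟨C, hC, hle⟩ := hdiff.isBigO_sub.exists_nonneg
  refine ⟨C * K, ?_⟩
  filter_upwards [eventually_forall_smul_of_norm_le hle.bound K] with ε hε A hA
  calc |jacobianPow q (ε • A) - 1| ≤ C * ‖ε • A‖ := by simpa [jacobianPow_zero] using hε A hA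
    _ = C * ‖A‖ * |ε| := by rw [norm_smul, Real.norm_eq_abs]; ring
    _ ≤ C * K * |ε| := by gcongr

section Integral

variable {q} {X : Type*} [MeasurableSpace X] {m : Measure X} {f : X → ℝ} {A : X → E →L[ℝ] E}

theorem exists_abs_integral_mul_jacobianPow_smul_sub_le (q K : ℝ) (m : Measure X) :
    ∃ C, ∀ᶠ ε in 𝓝 (0 : ℝ), ∀ (f : X → ℝ) (A : X → E →L[ℝ] E), Integrable f m → Measurable A →
      (∀ x, ‖A x‖ ≤ K) → |(∫ x, f x * jacobianPow q (ε • A x) ∂m) - ∫ x, f x ∂m| ≤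
        C * (∫ x, |f x| ∂m) * |ε| := by
  obtain ⟨C, hC⟩ := exists_abs_jacobianPow_smul_sub_one_le (E := E) q K
  refine ⟨C, hC.mono fun ε hε f A hf hA hK => ?_⟩
  have hJ : Integrable (fun x => f x * jacobianPow q (ε • A x)) m :=
    integrable_mul_jacobianPow hf (hA.const_smul ε) fun x => hε _ (hK x)
  rw [← integral_sub hJ hf, ← integral_const_mul, ← integral_mul_const]
  refine norm_integral_le_of_norm_le (G := ℝ) ((hf.abs.const_mul C).mul_const |ε|)
    (ae_of_all _ fun x => ?_)
  rw [← mul_sub_one, norm_mul, Real.norm_eq_abs, Real.norm_eq_abs, mul_comm C, mul_assoc]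
  exact mul_le_mul_of_nonneg_left (hε _ (hK x)) (abs_nonneg _)

theorem hasDerivAt_integral_mul_jacobianPow_smul {K : ℝ} (hf : Integrable f m) (hA : Measurable A)
    (hK : ∀ x, ‖A x‖ ≤ K) :
    HasDerivAt (fun ε : ℝ => ∫ x, f x * jacobianPow q (ε • A x) ∂m)
      ((1 - q) * ∫ x, LinearMap.trace ℝ E (A x) * f x ∂m) 0 := by
  obtain ⟨C, hC⟩ := exists_abs_jacobianPow_smul_sub_one_le (E := E) q K
  have hbound : ∀ᶠ z in 𝓝 (0 : ℝ) ×ˢ ae m,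
      ‖f z.2 * jacobianPow q (z.1 • A z.2) - f z.2 * jacobianPow q ((0 : ℝ) • A z.2)‖ ≤
        C * |f z.2| * ‖z.1 - 0‖ := by
    filter_upwards [hC.prod_inl (ae m)] with z hz
    rw [zero_smul, jacobianPow_zero, ← mul_sub, norm_mul, sub_zero, mul_comm C, mul_assoc]
    exact mul_le_mul_of_nonneg_left (hz _ (hK z.2)) (norm_nonneg _)
  have hderiv := (hasDerivAt_integral_of_norm_sub_le (ε₀ := (0 : ℝ))
    (f := fun ε x => f x * jacobianPow q (ε • A x))
    (.of_forall fun ε => hf.aestronglyMeasurable.mul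
      ((measurable_jacobianPow q).comp (hA.const_smul ε)).aestronglyMeasurable)
    (by simpa [jacobianPow_zero] using hf) hbound (hf.abs.const_mul C)
    (ae_of_all _ fun x => (hasDerivAt_jacobianPow_smul q (A x)).const_mul (f x))).2
  simpa only [mul_left_comm (f _), mul_comm (f _), integral_const_mul] using hderiv

end Integral

end Jacobian

theorem divergence_eq_trace {d : ℕ} (η : EucSp d → EucSp d) (x : EucSp d) :
    divergence η x = LinearMap.trace ℝ (EucSp d) (fderiv ℝ η x) := by
  rw [LinearMap.trace_eq_matrix_trace ℝ (EuclideanSpace.basisFun (Fin d) ℝ).toBasis]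
  simp [divergence, Matrix.trace, LinearMap.toMatrix_apply]

theorem measurable_divergence {d : ℕ} (η : EucSp d → EucSp d) : Measurable (divergence η) := by
  unfold divergence
  fun_prop

theorem abs_divergence_le {d : ℕ} {η : EucSp d → EucSp d} {K : ℝ≥0} (hη : LipschitzWith K η)
    (x : EucSp d) : |divergence η x| ≤ d * K := by
  calc |divergence η x| ≤ ∑ i, |fderiv ℝ η x (EuclideanSpace.single i 1) i| :=
        Finset.abs_sum_le_sum_abs _ _
    _ ≤ ∑ _i : Fin d, (K : ℝ) := by
        refine Finset.sum_le_sum fun i _ => ?_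
        rw [← Real.norm_eq_abs]
        refine (PiLp.norm_apply_le _ i).trans ?_
        simpa using (fderiv ℝ η x).le_of_opNorm_le (norm_fderiv_le_of_lipschitz ℝ hη)
          (EuclideanSpace.single i 1)
    _ = d * K := by simp

section NormRpow

variable {p : ℝ}

theorem abs_rpow_sub_rpow_le {x y R : ℝ} (hp : 1 ≤ p) (hx : x ∈ Icc 0 R) (hy : y ∈ Icc 0 R) :
    |x ^ p - y ^ p| ≤ p * R ^ (p - 1) * |x - y| := by
  refine (convex_Icc 0 R).norm_image_sub_le_of_norm_hasDerivWithin_le (f := fun s : ℝ => s ^ p)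
    (fun s _ => (Real.hasDerivAt_rpow_const (Or.inr hp)).hasDerivWithinAt) (fun s hs => ?_) hy hx
  rw [norm_mul, Real.norm_of_nonneg (by linarith),
    Real.norm_of_nonneg (Real.rpow_nonneg hs.1 _)]
  gcongr
  · exact hs.1
  · exact hs.2

theorem abs_norm_add_smul_rpow_sub_le {E : Type*} [NormedAddCommGroup E] [NormedSpace ℝ E]
    (hp : 1 ≤ p) (a b : E) {ε : ℝ} (hε : |ε| ≤ 1) :
    |‖a + ε • b‖ ^ p - ‖a‖ ^ p| ≤ p * (‖a‖ + ‖b‖) ^ p * |ε| := by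
  have hR : 0 ≤ ‖a‖ + ‖b‖ := by positivity
  have hεb : ‖ε • b‖ ≤ ‖b‖ * |ε| := by rw [norm_smul, Real.norm_eq_abs, mul_comm]
  have hmem : ‖a + ε • b‖ ∈ Icc 0 (‖a‖ + ‖b‖) := by
    refine ⟨norm_nonneg _, (norm_add_le _ _).trans ?_⟩
    gcongr
    exact hεb.trans (mul_le_of_le_one_right (norm_nonneg b) hε)
  calc |‖a + ε • b‖ ^ p - ‖a‖ ^ p|
      ≤ p * (‖a‖ + ‖b‖) ^ (p - 1) * |‖a + ε • b‖ - ‖a‖| :=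
        abs_rpow_sub_rpow_le hp hmem ⟨norm_nonneg _, by linarith [norm_nonneg b]⟩
    _ ≤ p * (‖a‖ + ‖b‖) ^ (p - 1) * ((‖a‖ + ‖b‖) * |ε|) := by
        gcongr
        calc |‖a + ε • b‖ - ‖a‖| ≤ ‖a + ε • b - a‖ := abs_norm_sub_norm_le _ _
          _ ≤ ‖b‖ * |ε| := by rwa [add_sub_cancel_left]
          _ ≤ (‖a‖ + ‖b‖) * |ε| := by gcongr; linarith [norm_nonneg a]
    _ = p * ((‖a‖ + ‖b‖) ^ (p - 1) * (‖a‖ + ‖b‖)) * |ε| := by ring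
    _ = p * (‖a‖ + ‖b‖) ^ p * |ε| := by
        rw [← Real.rpow_add_one' hR (by linarith), sub_add_cancel]

theorem add_rpow_le_of_le_mul_add_one {x y K : ℝ} (hp : 1 ≤ p) (hx : 0 ≤ x) (hy : 0 ≤ y)
    (hK : 0 ≤ K) (hxy : y ≤ K * (x + 1)) :
    (x + y) ^ p ≤ (1 + K) ^ p * 2 ^ (p - 1) * (x ^ p + 1) := by
  calc (x + y) ^ p ≤ ((1 + K) * (x + 1)) ^ p := by gcongr; linarith
    _ = (1 + K) ^ p * (x + 1) ^ p := Real.mul_rpow (by positivity) (by positivity)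
    _ ≤ (1 + K) ^ p * (2 ^ (p - 1) * (x ^ p + 1 ^ p)) := by
        gcongr
        exact_mod_cast NNReal.rpow_add_le_mul_rpow_add_rpow ⟨x, hx⟩ 1 hp
    _ = (1 + K) ^ p * 2 ^ (p - 1) * (x ^ p + 1) := by rw [Real.one_rpow]; ring

section Integral

variable {X E : Type*} [MeasurableSpace X] {m : Measure X} [NormedAddCommGroup E] {a b : X → E}

theorem integrable_norm_rpow_of_memLp (hp : 0 < p) (ha : MemLp a (ENNReal.ofReal p) m) :
    Integrable (fun x => ‖a x‖ ^ p) m := by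
  simpa [hp.le] using ha.integrable_norm_rpow (by simpa using hp) ENNReal.ofReal_ne_top

theorem integrable_norm_add_norm_rpow (hp : 0 < p) (ha : MemLp a (ENNReal.ofReal p) m)
    (hb : MemLp b (ENNReal.ofReal p) m) : Integrable (fun x => (‖a x‖ + ‖b x‖) ^ p) m := by
  refine (integrable_norm_rpow_of_memLp hp (ha.norm.add hb.norm)).congr (ae_of_all _ fun x => ?_)
  simp only [Pi.add_apply]
  rw [Real.norm_of_nonneg (by positivity)]

theorem abs_integral_norm_add_smul_rpow_sub_le [NormedSpace ℝ E] (hp : 1 ≤ p)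
    (ha : MemLp a (ENNReal.ofReal p) m) (hb : MemLp b (ENNReal.ofReal p) m) {ε : ℝ}
    (hε : |ε| ≤ 1) :
    |(∫ x, ‖a x + ε • b x‖ ^ p ∂m) - ∫ x, ‖a x‖ ^ p ∂m| ≤
      p * (∫ x, (‖a x‖ + ‖b x‖) ^ p ∂m) * |ε| := by
  have hp₀ : 0 < p := zero_lt_one.trans_le hp
  have hint : Integrable (fun x => ‖a x + ε • b x‖ ^ p) m :=
    integrable_norm_rpow_of_memLp hp₀ (ha.add (hb.const_smul ε))
  rw [← integral_sub hint (integrable_norm_rpow_of_memLp hp₀ ha), ← integral_const_mul,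
    ← integral_mul_const]
  exact norm_integral_le_of_norm_le (f := fun x => ‖a x + ε • b x‖ ^ p - ‖a x‖ ^ p)
    (((integrable_norm_add_norm_rpow hp₀ ha hb).const_mul p).mul_const _)
    (ae_of_all _ fun x => abs_norm_add_smul_rpow_sub_le hp (a x) (b x) hε)

theorem integral_norm_add_norm_rpow_le [IsFiniteMeasure m] {K : ℝ} (hp : 1 ≤ p) (hK : 0 ≤ K)
    (ha : MemLp a (ENNReal.ofReal p) m) (hb : MemLp b (ENNReal.ofReal p) m)
    (hab : ∀ x, ‖b x‖ ≤ K * (‖a x‖ + 1)) :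
    ∫ x, (‖a x‖ + ‖b x‖) ^ p ∂m ≤
      (1 + K) ^ p * 2 ^ (p - 1) * ((∫ x, ‖a x‖ ^ p ∂m) + m.real univ) := by
  have hp₀ : 0 < p := zero_lt_one.trans_le hp
  have hint := integrable_norm_rpow_of_memLp hp₀ ha
  calc ∫ x, (‖a x‖ + ‖b x‖) ^ p ∂m
      ≤ ∫ x, (1 + K) ^ p * 2 ^ (p - 1) * (‖a x‖ ^ p + 1) ∂m :=
        integral_mono (integrable_norm_add_norm_rpow hp₀ ha hb)
          ((hint.add (integrable_const 1)).const_mul _) fun x =>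
          add_rpow_le_of_le_mul_add_one hp (norm_nonneg _) (norm_nonneg _) hK (hab x)
    _ = (1 + K) ^ p * 2 ^ (p - 1) * ((∫ x, ‖a x‖ ^ p ∂m) + m.real univ) := by
        rw [integral_const_mul, integral_add hint (integrable_const 1)]
        simp

end Integral

section InnerProductSpace

variable {E : Type*} [NormedAddCommGroup E] [InnerProductSpace ℝ E]

theorem hasDerivAt_norm_add_smul_rpow (hp : 1 < p) (a b : E) :
    HasDerivAt (fun ε : ℝ => ‖a + ε • b‖ ^ p) (p * (‖a‖ ^ (p - 2) * inner ℝ b a)) 0 := by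
  have hline : HasDerivAt (fun ε : ℝ => a + ε • b) b 0 := by
    simpa using ((hasDerivAt_id (0 : ℝ)).smul_const b).const_add a
  convert! (hasFDerivAt_norm_rpow (a + (0 : ℝ) • b) hp).comp_hasDerivAt 0 hline using 1
  rw [smul_apply, innerSL_apply_apply, real_inner_comm, smul_eq_mul, mul_assoc, zero_smul, add_zero]

theorem hasDerivAt_integral_norm_add_smul_rpow {X : Type*} [MeasurableSpace X] {m : Measure X}
    {a b : X → E} (hp : 1 < p) (ha : MemLp a (ENNReal.ofReal p) m)
    (hb : MemLp b (ENNReal.ofReal p) m) :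
    Integrable (fun x => ‖a x‖ ^ (p - 2) * inner ℝ (b x) (a x)) m ∧
      HasDerivAt (fun ε : ℝ => ∫ x, ‖a x + ε • b x‖ ^ p ∂m)
        (p * ∫ x, ‖a x‖ ^ (p - 2) * inner ℝ (b x) (a x) ∂m) 0 := by
  have hp₀ : 0 < p := by linarith
  have hε : ∀ᶠ ε in 𝓝 (0 : ℝ), |ε| ≤ 1 := by
    simpa [Metric.closedBall] using! Metric.closedBall_mem_nhds (0 : ℝ) one_pos
  have hbound : ∀ᶠ z in 𝓝 (0 : ℝ) ×ˢ ae m, ‖‖a z.2 + z.1 • b z.2‖ ^ p -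
      ‖a z.2 + (0 : ℝ) • b z.2‖ ^ p‖ ≤ p * (‖a z.2‖ + ‖b z.2‖) ^ p * ‖z.1 - 0‖ := by
    filter_upwards [hε.prod_inl (ae m)] with z hz
    simpa using abs_norm_add_smul_rpow_sub_le hp.le (a z.2) (b z.2) hz
  obtain ⟨hint, hderiv⟩ := hasDerivAt_integral_of_norm_sub_le
    (.of_forall fun ε =>
      (integrable_norm_rpow_of_memLp hp₀ (ha.add (hb.const_smul ε))).aestronglyMeasurable)
    (integrable_norm_rpow_of_memLp hp₀ (ha.add (hb.const_smul 0))) hbound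
    ((integrable_norm_add_norm_rpow hp₀ ha hb).const_mul p)
    (ae_of_all _ fun x => hasDerivAt_norm_add_smul_rpow hp (a x) (b x))
  rw [integral_const_mul] at hderiv
  exact ⟨(integrable_const_mul_iff (isUnit_iff_ne_zero.2 hp₀.ne') _).1 hint, hderiv⟩

end InnerProductSpace

end NormRpow

section ChangeOfVariables

theorem exists_homeomorph_id_add {E : Type*} [NormedAddCommGroup E] [NormedSpace ℝ E]
    [CompleteSpace E] {η : E → E} {c : ℝ≥0} (hc : c < 1) (hη : LipschitzWith c η) :
    ∃ e : E ≃ₜ E, ⇑e = fun x => x + η x := by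
  have happrox : ApproximatesLinearOn (fun x => x + η x)
      (ContinuousLinearEquiv.refl ℝ E : E →L[ℝ] E) univ c := by
    refine LipschitzOnWith.approximatesLinearOn ?_
    simpa [Pi.sub_def] using hη
  refine ⟨happrox.toHomeomorph _ ?_, rfl⟩
  refine (subsingleton_or_nontrivial E).imp_right fun (_ : Nontrivial E) => ?_
  have hnorm : ‖ContinuousLinearMap.id ℝ E‖₊ = 1 := NNReal.eq ContinuousLinearMap.norm_id
  simpa [hnorm] using hc

variable {E : Type*} [NormedAddCommGroup E] [NormedSpace ℝ E] [FiniteDimensional ℝ E]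
  [MeasurableSpace E] [BorelSpace E] {m : Measure E} [m.IsAddHaarMeasure] {e : E ≃ₜ E}

theorem setLIntegral_eq_setLIntegral_preimage_abs_det_fderiv_mul (he : Differentiable ℝ e)
    {s : Set E} (hs : MeasurableSet s) (g : E → ℝ≥0∞) :
    ∫⁻ y in s, g y ∂m = ∫⁻ x in e ⁻¹' s, ENNReal.ofReal |(fderiv ℝ e x).det| * g (e x) ∂m := by
  rw [← lintegral_image_eq_lintegral_abs_det_fderiv_mul m (e.continuous.measurable hs)
    (fun x _ => (he x).hasFDerivAt.hasFDerivWithinAt) e.injective.injOn,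
    image_preimage_eq s e.surjective]

theorem map_eq_withDensity_rnDeriv_div_abs_det (he : Differentiable ℝ e)
    (hdet : ∀ x, (fderiv ℝ e x).det ≠ 0) {ν : Measure E} [SigmaFinite ν] (hν : ν ≪ m) :
    ν.map e = m.withDensity fun y =>
      ν.rnDeriv m (e.symm y) / ENNReal.ofReal |(fderiv ℝ e (e.symm y)).det| := by
  ext s hs
  rw [Measure.map_apply e.continuous.measurable hs, withDensity_apply _ hs,
    setLIntegral_eq_setLIntegral_preimage_abs_det_fderiv_mul he hs,
    ← Measure.setLIntegral_rnDeriv hν (e ⁻¹' s)]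
  refine lintegral_congr fun x => ?_
  rw [e.symm_apply_apply, ENNReal.mul_div_cancel (by simpa using hdet x) ENNReal.ofReal_ne_top]

theorem Lq_map_homeomorph {d : ℕ} {e : EucSp d ≃ₜ EucSp d} {q : ℝ} (hq : 0 ≤ q)
    (he : Differentiable ℝ e) (hdet : ∀ x, (fderiv ℝ e x).det ≠ 0) {ν : Measure (EucSp d)}
    [SigmaFinite ν] (hν : ν ≪ volume) :
    Lq q (ν.map e) =
      ∫⁻ x, ν.rnDeriv volume x ^ q * ENNReal.ofReal (|(fderiv ℝ e x).det| ^ (1 - q)) := by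
  have hmap := map_eq_withDensity_rnDeriv_div_abs_det he hdet hν
  have hdens : Measurable fun y =>
      ν.rnDeriv volume (e.symm y) / ENNReal.ofReal |(fderiv ℝ e (e.symm y)).det| := by
    have hJ : Measurable fun x => |(fderiv ℝ e x).det| :=
      (ContinuousLinearMap.continuous_det.measurable.comp (measurable_fderiv ℝ e)).abs
    exact ((Measure.measurable_rnDeriv ν volume).div hJ.ennreal_ofReal).comp
      e.symm.continuous.measurable
  have hrn : (ν.map e).rnDeriv volume =ᵐ[volume] fun y =>
      ν.rnDeriv volume (e.symm y) / ENNReal.ofReal |(fderiv ℝ e (e.symm y)).det| := by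
    rw [hmap]
    exact Measure.rnDeriv_withDensity _ hdens
  rw [Lq, if_pos (hmap ▸ withDensity_absolutelyContinuous _ _),
    lintegral_congr_ae (hrn.mono fun y hy => congrArg (· ^ q) hy), ← setLIntegral_univ,
    setLIntegral_eq_setLIntegral_preimage_abs_det_fderiv_mul he MeasurableSet.univ, preimage_univ,
    setLIntegral_univ]
  refine lintegral_congr fun x => ?_
  have hpos : 0 < |(fderiv ℝ e x).det| := abs_pos.2 (hdet x)
  rw [e.symm_apply_apply, ENNReal.div_rpow_of_nonneg _ _ hq, ← ENNReal.ofReal_rpow_of_pos hpos,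
    ENNReal.rpow_sub _ _ (by simpa using hdet x) ENNReal.ofReal_ne_top, ENNReal.rpow_one,
    div_eq_mul_inv, div_eq_mul_inv, mul_left_comm]

end ChangeOfVariables

section InternalEnergy

variable {d : ℕ} {q : ℝ} {K : ℝ≥0} {η : EucSp d → EucSp d} {ν : Measure (EucSp d)} {ε : ℝ}

theorem exists_homeomorph_id_add_smul {E : Type*} [NormedAddCommGroup E] [NormedSpace ℝ E]
    [CompleteSpace E] {η : E → E} (hη : LipschitzWith K η) (hε : |ε| * K < 1) :
    ∃ e : E ≃ₜ E, ⇑e = fun x => x + ε • η x :=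
  exists_homeomorph_id_add (c := ‖ε‖₊ * K) (by exact_mod_cast hε)
    ((lipschitzWith_smul ε).comp hη)

theorem fderiv_id_add_smul {E : Type*} [NormedAddCommGroup E] [NormedSpace ℝ E] {η : E → E} {x : E}
    (hη : DifferentiableAt ℝ η x) (ε : ℝ) :
    fderiv ℝ (fun x => x + ε • η x) x = 1 + ε • fderiv ℝ η x :=
  ((hasFDerivAt_id x).add (hη.hasFDerivAt.const_smul ε)).fderiv

theorem eventually_abs_mul_lt_one (K : ℝ) : ∀ᶠ ε in 𝓝 (0 : ℝ), |ε| * K < 1 := by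
  have hlim : Tendsto (fun ε : ℝ => |ε| * K) (𝓝 0) (𝓝 0) := by
    simpa using (tendsto_norm_zero (E := ℝ)).mul_const K
  exact hlim.eventually_lt_const one_pos

theorem Lq_eq_lintegral (hν : ν ≪ volume) : Lq q ν = ∫⁻ x, ν.rnDeriv volume x ^ q :=
  if_pos hν

theorem Lq_pos [SigmaFinite ν] (hq : 0 < q) (hν₀ : ν ≠ 0) : 0 < Lq q ν := by
  by_cases hν : ν ≪ volume
  · rw [Lq_eq_lintegral hν, pos_iff_ne_zero, Ne,
      lintegral_eq_zero_iff ((Measure.measurable_rnDeriv _ _).pow_const q)]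
    intro hzero
    have hu : ν.rnDeriv volume =ᵐ[volume] 0 := by
      filter_upwards [hzero] with x hx
      simpa [hq.not_gt, hq] using hx
    exact hν₀ (by rw [← Measure.withDensity_rnDeriv_eq ν volume hν, withDensity_congr_ae hu,
      withDensity_zero])
  · simp [Lq, hν]

theorem integrable_rnDeriv_toReal_rpow (hν : ν ≪ volume) (hfin : Lq q ν < ⊤) :
    Integrable fun x => (ν.rnDeriv volume x).toReal ^ q := by
  simp_rw [ENNReal.toReal_rpow]
  rw [Lq_eq_lintegral hν] at hfin
  exact integrable_toReal_of_lintegral_ne_top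
    ((Measure.measurable_rnDeriv _ _).pow_const q).aemeasurable hfin.ne

theorem toReal_Lq_eq_integral [SigmaFinite ν] (hq : 0 ≤ q) (hν : ν ≪ volume) :
    (Lq q ν).toReal = ∫ x, (ν.rnDeriv volume x).toReal ^ q := by
  simp_rw [ENNReal.toReal_rpow]
  rw [Lq_eq_lintegral hν,
    integral_toReal ((Measure.measurable_rnDeriv _ _).pow_const q).aemeasurable]
  filter_upwards [Measure.rnDeriv_lt_top ν volume] with x hx
  exact ENNReal.rpow_lt_top_of_nonneg hq hx.ne

theorem toReal_Lq_map_id_add_smul [SigmaFinite ν] (hq : 0 ≤ q) (hη : LipschitzWith K η)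
    (hη' : Differentiable ℝ η) (hε : |ε| * K < 1) (hν : ν ≪ volume) :
    (Lq q (ν.map fun x => x + ε • η x)).toReal =
      ∫ x, (ν.rnDeriv volume x).toReal ^ q * jacobianPow q (ε • fderiv ℝ η x) := by
  obtain ⟨e, he⟩ := exists_homeomorph_id_add_smul hη hε
  have hfderiv (x : EucSp d) : fderiv ℝ e x = 1 + ε • fderiv ℝ η x := by
    rw [he, fderiv_id_add_smul (hη' x)]
  have hnorm (x : EucSp d) : ‖ε • fderiv ℝ η x‖ < 1 := by
    rw [norm_smul]
    exact (mul_le_mul_of_nonneg_left (norm_fderiv_le_of_lipschitz ℝ hη) (norm_nonneg ε)).trans_lt hε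
  rw [← he, Lq_map_homeomorph hq (he ▸ differentiable_id.add (hη'.const_smul ε))
    (fun x => hfderiv x ▸ det_one_add_ne_zero (hnorm x)) hν]
  simp_rw [hfderiv]
  have hmeas : Measurable fun x => ν.rnDeriv volume x ^ q *
      ENNReal.ofReal (jacobianPow q (ε • fderiv ℝ η x)) :=
    ((Measure.measurable_rnDeriv _ _).pow_const q).mul
      ((measurable_jacobianPow q).comp ((measurable_fderiv ℝ η).const_smul ε)).ennreal_ofReal
  refine (integral_toReal hmeas.aemeasurable ?_).symm.trans (integral_congr_ae ?_)
  · filter_upwards [Measure.rnDeriv_lt_top ν volume] with x hx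
    exact ENNReal.mul_lt_top (ENNReal.rpow_lt_top_of_nonneg hq hx.ne) ENNReal.ofReal_lt_top
  · refine ae_of_all _ fun x => ?_
    simp only [ENNReal.toReal_mul, ENNReal.toReal_rpow,
      ENNReal.toReal_ofReal (jacobianPow_nonneg q _)]

theorem exists_abs_toReal_Lq_map_sub_le (hq : 0 ≤ q) (d : ℕ) (K : ℝ≥0) :
    ∃ C, ∀ᶠ ε in 𝓝 (0 : ℝ), ∀ η : EucSp d → EucSp d, LipschitzWith K η → Differentiable ℝ η →
      ∀ (ν : Measure (EucSp d)) [SigmaFinite ν], ν ≪ volume → Lq q ν < ⊤ →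
        |(Lq q (ν.map fun x => x + ε • η x)).toReal - (Lq q ν).toReal| ≤
          C * (Lq q ν).toReal * |ε| := by
  obtain ⟨C, hC⟩ := exists_abs_integral_mul_jacobianPow_smul_sub_le (E := EucSp d) q K
    (volume : Measure (EucSp d))
  refine ⟨C, ?_⟩
  filter_upwards [hC, eventually_abs_mul_lt_one K] with ε hle hε η hη hη' ν _ hν hfin
  rw [toReal_Lq_map_id_add_smul hq hη hη' hε hν, toReal_Lq_eq_integral hq hν]
  refine (hle _ _ (integrable_rnDeriv_toReal_rpow hν hfin) (measurable_fderiv ℝ η)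
    fun x => norm_fderiv_le_of_lipschitz ℝ hη).trans_eq ?_
  simp_rw [abs_of_nonneg (Real.rpow_nonneg ENNReal.toReal_nonneg q)]

theorem integrable_divergence_mul_rnDeriv_rpow (hη : LipschitzWith K η) (hν : ν ≪ volume)
    (hfin : Lq q ν < ⊤) :
    Integrable fun x => divergence η x * (ν.rnDeriv volume x).toReal ^ q :=
  (integrable_rnDeriv_toReal_rpow hν hfin).bdd_mul (measurable_divergence η).aestronglyMeasurable
    (ae_of_all _ (abs_divergence_le hη))

theorem hasDerivAt_toReal_Lq_map [SigmaFinite ν] (hq : 0 ≤ q) (hη : LipschitzWith K η)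
    (hη' : Differentiable ℝ η) (hν : ν ≪ volume) (hfin : Lq q ν < ⊤) :
    HasDerivAt (fun ε : ℝ => (Lq q (ν.map fun x => x + ε • η x)).toReal)
      ((1 - q) * ∫ x, divergence η x * (ν.rnDeriv volume x).toReal ^ q) 0 := by
  simp_rw [divergence_eq_trace]
  exact (hasDerivAt_integral_mul_jacobianPow_smul (integrable_rnDeriv_toReal_rpow hν hfin)
    (measurable_fderiv ℝ η) fun x => norm_fderiv_le_of_lipschitz ℝ hη).congr_of_eventuallyEq
    ((eventually_abs_mul_lt_one K).mono fun ε hε => toReal_Lq_map_id_add_smul hq hη hη' hε hν)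

end InternalEnergy

section TransportedField

variable {d : ℕ} {p : ℝ} {μ : ℝ → Measure (EucSp d)} {T v : ℝ → EucSp d → EucSp d} {t : ℝ}

theorem rnDeriv_map_withDensityᵥ_comp {X Y : Type*} [MeasurableSpace X] [MeasurableSpace Y]
    {m : Measure X} (e : X ≃ᵐ Y) {f : X → ℝ} (hf : Integrable f m) :
    SignedMeasure.rnDeriv ((m.withDensityᵥ f).map e) (m.map e) ∘ e =ᵐ[m] f := by
  have hg : Integrable (f ∘ e.symm) (m.map e) := by
    rw [e.measurableEmbedding.integrable_map_iff]
    simpa [Function.comp_def] using hf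
  have hmap : (m.withDensityᵥ f).map e = (m.map e).withDensityᵥ (f ∘ e.symm) := by
    ext s hs
    rw [VectorMeasure.map_apply _ e.measurable hs, withDensityᵥ_apply hf (e.measurable hs),
      withDensityᵥ_apply hg hs, e.measurableEmbedding.setIntegral_map]
    simp
  have hrn : f ∘ e.symm =ᵐ[m.map e] SignedMeasure.rnDeriv ((m.withDensityᵥ f).map e) (m.map e) :=
    SignedMeasure.eq_rnDeriv 0 _ hg VectorMeasure.MutuallySingular.zero_left
      (by rw [hmap, zero_add])
  filter_upwards [ae_of_ae_map e.measurable.aemeasurable hrn] with x hx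
  simpa using hx.symm

theorem transportedField_apply_ae_eq {e : EucSp d ≃ₜ EucSp d} (he : T t = e)
    (hint : Integrable (lagrangianField T v t) (μ t)) :
    ∀ᵐ x ∂μ t, transportedField T μ v t (T t x) = lagrangianField T v t x := by
  have hcomp (i : Fin d) : Integrable (fun x => lagrangianField T v t x i) (μ t) :=
    (EuclideanSpace.proj (𝕜 := ℝ) i : EucSp d →L[ℝ] ℝ).integrable_comp hint
  filter_upwards [ae_all_iff.2 fun i =>
    rnDeriv_map_withDensityᵥ_comp e.toMeasurableEquiv (hcomp i)] with x hx
  ext i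
  simpa [transportedField, pushCurve, he] using hx i

theorem kinetic_transportedField {e : EucSp d ≃ₜ EucSp d} (he : T t = e)
    (hint : Integrable (lagrangianField T v t) (μ t)) :
    kinetic p (pushCurve T μ) (transportedField T μ v) t = kinetic p μ (lagrangianField T v) t := by
  rw [kinetic, pushCurve, he, e.measurableEmbedding.lintegral_map, ← he]
  refine lintegral_congr_ae ?_
  filter_upwards [transportedField_apply_ae_eq he hint] with x hx
  rw [hx]

theorem toReal_kinetic_eq_integral (hp : 0 ≤ p) (hv : AEStronglyMeasurable (v t) (μ t)) :
    (kinetic p μ v t).toReal = ∫ x, ‖v t x‖ ^ p ∂μ t := by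
  rw [kinetic, ← integral_toReal (hv.enorm.pow_const p)
    (ae_of_all _ fun x => ENNReal.rpow_lt_top_of_nonneg hp enorm_ne_top)]
  simp only [← ENNReal.toReal_rpow, toReal_enorm]

theorem kinetic_lt_top_of_memLp (hp : 0 < p) (hv : MemLp (v t) (ENNReal.ofReal p) (μ t)) :
    kinetic p μ v t < ⊤ := by
  simpa [kinetic, hp.le] using
    lintegral_rpow_enorm_lt_top_of_eLpNorm_lt_top (by simpa using hp) ENNReal.ofReal_ne_top hv.2

end TransportedField

section Perturbation

variable {d : ℕ} {K : ℝ≥0} {ξ v : ℝ → EucSp d → EucSp d} {t : ℝ}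

theorem differentiable_slice (hξ : Differentiable ℝ (Function.uncurry ξ)) (t : ℝ) :
    Differentiable ℝ (ξ t) :=
  hξ.comp (differentiable_const t |>.prodMk differentiable_id)

theorem lipschitzWith_slice (hK : LipschitzWith K (Function.uncurry ξ)) (t : ℝ) :
    LipschitzWith K (ξ t) := by
  simpa using! hK.comp (LipschitzWith.prodMk_left t)

theorem norm_lagrangianField_le (hK : LipschitzWith K (Function.uncurry ξ)) (t : ℝ) (x : EucSp d) :
    ‖lagrangianField ξ v t x‖ ≤ K * (‖v t x‖ + 1) := by
  have htime : LipschitzWith K fun s => ξ s x := by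
    simpa using! hK.comp (LipschitzWith.prodMk_right x)
  calc ‖lagrangianField ξ v t x‖
      ≤ ‖fderiv ℝ (ξ t) x (v t x)‖ + ‖deriv (fun s => ξ s x) t‖ := norm_add_le _ _
    _ ≤ K * ‖v t x‖ + K := add_le_add
        (ContinuousLinearMap.le_of_opNorm_le _
          (norm_fderiv_le_of_lipschitz ℝ (lipschitzWith_slice hK t)) _)
        (norm_deriv_le_of_lipschitz htime)
    _ = K * (‖v t x‖ + 1) := by ring

theorem continuous_perturb (hξ : Continuous (Function.uncurry ξ)) (ε : ℝ) :
    Continuous (Function.uncurry (perturb ξ ε)) :=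
  continuous_snd.add (hξ.const_smul ε)

theorem lagrangianField_perturb (hξ : Differentiable ℝ (Function.uncurry ξ)) (ε t : ℝ)
    (x : EucSp d) :
    lagrangianField (perturb ξ ε) v t x = v t x + ε • lagrangianField ξ v t x := by
  have htime : DifferentiableAt ℝ (fun s => ξ s x) t :=
    DifferentiableAt.comp (g := Function.uncurry ξ) (f := fun s => (s, x)) t (hξ (t, x))
      (differentiableAt_id.prodMk (differentiableAt_const x))
  have hspace : fderiv ℝ (perturb ξ ε t) x = ContinuousLinearMap.id ℝ _ + ε • fderiv ℝ (ξ t) x :=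
    fderiv_id_add_smul (differentiable_slice hξ t x) ε
  simp only [lagrangianField, hspace, perturb]
  rw [deriv_const_add, deriv_fun_const_smul ε htime, smul_add, ← add_assoc]
  rfl

theorem lagrangianField_perturb_zero (hξ : Differentiable ℝ (Function.uncurry ξ)) :
    lagrangianField (perturb ξ 0) v = v := by
  ext1 t
  ext1 x
  rw [lagrangianField_perturb hξ, zero_smul, add_zero]

theorem pushCurve_perturb_zero (ξ : ℝ → EucSp d → EucSp d) (μ : ℝ → Measure (EucSp d)) :
    pushCurve (perturb ξ 0) μ = μ := by
  ext1 t
  have hid : perturb ξ 0 t = id := by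
    ext1 x
    simp [perturb]
  simp [pushCurve, hid]

theorem measurable_lagrangianField (hξ : Continuous (Function.uncurry ξ))
    (hv : Measurable (Function.uncurry v)) :
    Measurable (Function.uncurry (lagrangianField ξ v)) := by
  have hderiv : Measurable fun z : ℝ × EucSp d => deriv (fun s => ξ s z.2) z.1 :=
    (measurable_deriv_with_param (f := fun x s => ξ s x) (hξ.comp continuous_swap)).comp
      measurable_swap
  exact ((ContinuousLinearMap.measurable_apply₂ (E := EucSp d) (F := EucSp d)).comp
    ((measurable_fderiv_with_param ℝ hξ).prodMk hv)).add hderiv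

end Perturbation

section Measurability

open ProbabilityTheory

theorem exists_tendsto_indicator_of_isBounded {E : Type*} [NormedAddCommGroup E] [NormedSpace ℝ E]
    [FiniteDimensional ℝ E] {s : Set E} (hs : IsOpen s) (hb : Bornology.IsBounded s) :
    ∃ φ : ℕ → E → ℝ, (∀ n, ContDiff ℝ ∞ (φ n)) ∧ (∀ n, HasCompactSupport (φ n)) ∧
      (∀ n x, ‖φ n x‖ ≤ 1) ∧ ∀ x, Tendsto (φ · x) atTop (𝓝 (s.indicator 1 x)) := by
  obtain ⟨f, rfl, hf, hf_range⟩ := hs.exists_contDiff_support_eq (n := ⊤)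
  refine ⟨fun n x => Real.smoothTransition (n * f x), fun n => ?_, fun n => ?_, fun n x => ?_,
    fun x => ?_⟩
  · exact Real.smoothTransition.contDiff.comp (contDiff_const.mul hf)
  · refine .of_support_subset_isCompact hb.isCompact_closure fun x hx => subset_closure ?_
    contrapose! hx
    simp_all
  · rw [Real.norm_of_nonneg (Real.smoothTransition.nonneg _)]
    exact Real.smoothTransition.le_one _
  · rcases (hf_range (mem_range_self x)).1.eq_or_lt with hx | hx
    · simp [← hx]
    · rw [indicator_of_mem (by exact hx.ne')]
      refine tendsto_const_nhds.congr' ?_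
      filter_upwards [((tendsto_natCast_atTop_atTop (R := ℝ)).atTop_mul_const hx
        ).eventually_ge_atTop 1] with n hn
      exact (Real.smoothTransition.one_of_one_le hn).symm

theorem borel_eq_generateFrom_isOpen_isBounded (E : Type*) [PseudoMetricSpace E] :
    borel E = .generateFrom {s | IsOpen s ∧ Bornology.IsBounded s} := by
  refine le_antisymm (MeasurableSpace.generateFrom_le fun s hs => ?_)
    (MeasurableSpace.generateFrom_mono fun s hs => hs.1)
  rcases isEmpty_or_nonempty E with _ | ⟨⟨x⟩⟩
  · rw [s.eq_empty_of_isEmpty]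
    exact MeasurableSpace.measurableSet_empty _
  · rw [← inter_univ s, ← Metric.iUnion_ball_nat x, inter_iUnion]
    exact .iUnion fun n => MeasurableSpace.measurableSet_generateFrom
      ⟨IsOpen.inter hs Metric.isOpen_ball, Metric.isBounded_ball.subset inter_subset_right⟩

variable {S : Type*} [MeasurableSpace S]

theorem measurable_of_forall_measurable_integral {E : Type*} [NormedAddCommGroup E]
    [NormedSpace ℝ E] [FiniteDimensional ℝ E] [MeasurableSpace E] [BorelSpace E]
    {μ : S → Measure E} [∀ t, IsProbabilityMeasure (μ t)]
    (hμ : ∀ φ : E → ℝ, ContDiff ℝ ∞ φ → HasCompactSupport φ → Measurable fun t => ∫ x, φ x ∂μ t) :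
    Measurable μ := by
  refine .measure_of_isPiSystem_of_isProbabilityMeasure
    (BorelSpace.measurable_eq.trans (borel_eq_generateFrom_isOpen_isBounded E))
    (fun s hs t ht _ => ⟨hs.1.inter ht.1, hs.2.subset inter_subset_left⟩) fun s ⟨hs, hb⟩ => ?_
  obtain ⟨φ, hφ, hφ_supp, hφ_le, hφ_lim⟩ := exists_tendsto_indicator_of_isBounded hs hb
  have hreal : Measurable fun t => (μ t).real s := by
    refine measurable_of_tendsto_metrizable (fun n => hμ (φ n) (hφ n) (hφ_supp n))
      (tendsto_pi_nhds.2 fun t => ?_)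
    rw [← integral_indicator_one hs.measurableSet]
    exact tendsto_integral_of_dominated_convergence (fun _ => 1)
      (fun n => (hφ n).continuous.aestronglyMeasurable) (integrable_const 1)
      (fun n => ae_of_all _ (hφ_le n)) (ae_of_all _ hφ_lim)
  simpa [Measure.real] using hreal.ennreal_ofReal

variable {τ : Measure S} {E : Type*} [MeasurableSpace E] {μ : S → Measure E}

theorem exists_isMarkovKernel_ae_eq [Nonempty E] (hμ : AEMeasurable μ τ)
    (hprob : ∀ᵐ t ∂τ, IsProbabilityMeasure (μ t)) :
    ∃ κ : Kernel S E, IsMarkovKernel κ ∧ μ =ᵐ[τ] κ := by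
  obtain ⟨κ, hκ, hκ_prob, hμκ⟩ := hμ.exists_ae_eq_range_subset (t := {ν | IsProbabilityMeasure ν})
    hprob ⟨Measure.dirac (Classical.arbitrary E), Measure.dirac.isProbabilityMeasure⟩
  exact ⟨⟨κ, hκ⟩, ⟨fun t => hκ_prob (mem_range_self t)⟩, hμκ⟩

theorem aemeasurable_map [Nonempty E] {F : Type*} [MeasurableSpace F] {T : S → E → F}
    (hμ : AEMeasurable μ τ) (hprob : ∀ᵐ t ∂τ, IsProbabilityMeasure (μ t))
    (hT : Measurable (Function.uncurry T)) : AEMeasurable (fun t => (μ t).map (T t)) τ := by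
  obtain ⟨κ, _, hμκ⟩ := exists_isMarkovKernel_ae_eq hμ hprob
  refine AEMeasurable.congr (Measurable.aemeasurable
    (Measure.measurable_of_measurable_coe (fun t => (κ t).map (T t)) fun s hs => ?_))
    (hμκ.symm.mono fun t ht => by simp only [ht])
  have hTt (t : S) : Measurable (T t) := hT.comp measurable_prodMk_left
  simp_rw [fun t => Measure.map_apply (μ := κ t) (hTt t) hs]
  exact Kernel.measurable_kernel_prodMk_left (hT hs)

theorem aemeasurable_lintegral [Nonempty E] {f : S → E → ℝ≥0∞} (hμ : AEMeasurable μ τ)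
    (hprob : ∀ᵐ t ∂τ, IsProbabilityMeasure (μ t)) (hf : Measurable (Function.uncurry f)) :
    AEMeasurable (fun t => ∫⁻ x, f t x ∂μ t) τ := by
  obtain ⟨κ, _, hμκ⟩ := exists_isMarkovKernel_ae_eq hμ hprob
  exact (Measurable.lintegral_kernel_prod_right (κ := κ) hf).aemeasurable.congr
    (hμκ.symm.mono fun t ht => by simp only [ht])

section Density

variable [MeasurableSpace.CountablyGenerated E] (κ : Kernel S E) [IsFiniteKernel κ]
  (ν : Measure E) [SigmaFinite ν]

theorem measurableSet_absolutelyContinuous_kernel : MeasurableSet {t | κ t ≪ ν} := by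
  convert Kernel.measurableSet_absolutelyContinuous κ (Kernel.const S ν.toFinite) using 3 with t
  exact ⟨fun h => h.trans (absolutelyContinuous_toFinite ν),
    fun h => h.trans (toFinite_absolutelyContinuous ν)⟩

theorem exists_measurable_rnDeriv_kernel :
    ∃ u : S → E → ℝ≥0∞, Measurable (Function.uncurry u) ∧
      ∀ t, (κ t).rnDeriv ν =ᵐ[ν] u t := by
  have hν := absolutelyContinuous_toFinite ν
  refine ⟨fun t x => κ.rnDeriv (Kernel.const S ν.toFinite) t x * ν.toFinite.rnDeriv ν x,
    (Kernel.measurable_rnDeriv κ _).mul ((Measure.measurable_rnDeriv _ _).comp measurable_snd),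
    fun t => ?_⟩
  filter_upwards [hν.ae_le (Kernel.rnDeriv_eq_rnDeriv_measure (κ := κ)
      (η := Kernel.const S ν.toFinite) (a := t)),
    hν.ae_le (Measure.rnDeriv_mul_rnDeriv' (μ := κ t) (toFinite_absolutelyContinuous ν))]
    with x hx hx'
  rw [← hx', Pi.mul_apply, hx, Kernel.const_apply]

end Density

end Measurability

section MeasurabilityOfFunctionals

variable {d : ℕ} {p q : ℝ} {τ : Measure ℝ} {Ω : Set (EucSp d)} {μ : ℝ → Measure (EucSp d)}
  {v ξ : ℝ → EucSp d → EucSp d}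

theorem aemeasurable_Lq (hμ : AEMeasurable μ τ) (hprob : ∀ᵐ t ∂τ, IsProbabilityMeasure (μ t)) :
    AEMeasurable (fun t => Lq q (μ t)) τ := by
  classical
  obtain ⟨κ, _, hμκ⟩ := exists_isMarkovKernel_ae_eq hμ hprob
  obtain ⟨u, hu, hκu⟩ := exists_measurable_rnDeriv_kernel κ volume
  have hLq (t : ℝ) : Lq q (κ t) = if κ t ≪ volume then ∫⁻ x, u t x ^ q else ⊤ := by
    rw [Lq, lintegral_congr_ae ((hκu t).mono fun x hx => by rw [hx])]
  have hmeas : Measurable fun t => Lq q (κ t) := by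
    simp_rw [hLq]
    exact .ite (measurableSet_absolutelyContinuous_kernel κ volume)
      (hu.pow_const q).lintegral_prod_right' measurable_const
  exact hmeas.aemeasurable.congr (hμκ.symm.mono fun t ht => by simp only [ht])

/-- The fields that are jointly Borel up to modification on `μ_t`-null sets, for `τ`-a.e. `t`. Only
the values on `[0,1] × Ω` of a velocity field are Borel, but this weaker property suffices. -/
def IsAEMeasurableField (τ : Measure ℝ) (μ : ℝ → Measure (EucSp d)) (v : ℝ → EucSp d → EucSp d) :
    Prop :=
  ∃ w : ℝ → EucSp d → EucSp d, Measurable (Function.uncurry w) ∧ ∀ᵐ t ∂τ, v t =ᵐ[μ t] w t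

theorem isAEMeasurableField_of_measurable_domRestrict (hΩ : MeasurableSet Ω)
    (hv : Measurable ((Icc (0 : ℝ) 1 ×ˢ Ω).domRestrict (Function.uncurry v)))
    (hμΩ : ∀ᵐ t ∂volume.restrict (Icc (0 : ℝ) 1), μ t Ωᶜ = 0) :
    IsAEMeasurableField (volume.restrict (Icc 0 1)) μ v := by
  have hS : MeasurableSet (Icc (0 : ℝ) 1 ×ˢ Ω) := measurableSet_Icc.prod hΩ
  refine ⟨fun t x => (Icc (0 : ℝ) 1 ×ˢ Ω).indicator (Function.uncurry v) (t, x), ?_, ?_⟩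
  · refine measurable_of_restrict_of_restrict_compl hS ?_ ?_
    · convert hv using 1
      ext1 z
      exact indicator_of_mem z.2 _
    · convert (measurable_const : Measurable fun _ => (0 : EucSp d)) using 1
      ext1 z
      exact indicator_of_notMem z.2 _
  · filter_upwards [hμΩ, ae_restrict_mem measurableSet_Icc] with t htΩ ht
    filter_upwards [mem_ae_iff.2 htΩ] with x hx
    have htx : (t, x) ∈ Icc (0 : ℝ) 1 ×ˢ Ω := ⟨ht, hx⟩
    exact (indicator_of_mem htx (Function.uncurry v)).symm

namespace IsAEMeasurableField

theorem ae_aestronglyMeasurable (hv : IsAEMeasurableField τ μ v) :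
    ∀ᵐ t ∂τ, AEStronglyMeasurable (v t) (μ t) := by
  obtain ⟨w, hw, hvw⟩ := hv
  filter_upwards [hvw] with t ht
  exact (hw.comp measurable_prodMk_left).aestronglyMeasurable.congr ht.symm

theorem lagrangianField (hv : IsAEMeasurableField τ μ v) (hξ : Continuous (Function.uncurry ξ)) :
    IsAEMeasurableField τ μ (lagrangianField ξ v) := by
  obtain ⟨w, hw, hvw⟩ := hv
  refine ⟨_, measurable_lagrangianField hξ hw, ?_⟩
  filter_upwards [hvw] with t ht
  filter_upwards [ht] with x hx
  simp only [WeightedGeodesic.lagrangianField, hx]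

theorem aemeasurable_kinetic (hv : IsAEMeasurableField τ μ v) (hμ : AEMeasurable μ τ)
    (hprob : ∀ᵐ t ∂τ, IsProbabilityMeasure (μ t)) : AEMeasurable (kinetic p μ v) τ := by
  obtain ⟨w, hw, hvw⟩ := hv
  refine (aemeasurable_lintegral (f := fun t x => ‖w t x‖ₑ ^ p) hμ hprob
    (hw.enorm.pow_const p)).congr ?_
  filter_upwards [hvw] with t ht
  exact lintegral_congr_ae (ht.symm.mono fun x hx => by simp only [hx])

end IsAEMeasurableField

theorem IsVelocityField.continuousOn_integral (hv : IsVelocityField p Ω μ v) {φ : EucSp d → ℝ}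
    (hφ : ContDiff ℝ 1 φ) (hφ_supp : HasCompactSupport φ) :
    ContinuousOn (fun t => ∫ x, φ x ∂μ t) (Icc 0 1) := by
  have hprim (t : ℝ) (ht : t ∈ Icc (0 : ℝ) 1) : ∫ x, φ x ∂μ t =
      ∫ x, φ x ∂μ 0 + ∫ s in (0 : ℝ)..t, ∫ x, fderiv ℝ φ x (v s x) ∂μ s := by
    rcases ht.1.eq_or_lt with rfl | ht₀
    · simp
    · rw [← hv.continuity_eq φ hφ hφ_supp 0 (by simp) t ht ht₀, add_sub_cancel]
  refine ContinuousOn.congr (continuousOn_const.add ?_) hprim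
  rw [← uIcc_of_le zero_le_one]
  exact intervalIntegral.continuousOn_primitive_interval
    (by simpa only [uIcc_of_le zero_le_one] using hv.integrable φ hφ hφ_supp)

theorem IsVelocityField.aemeasurable (hv : IsVelocityField p Ω μ v)
    (hμ : ∀ t ∈ Icc (0 : ℝ) 1, IsProbabilityMeasure (μ t)) :
    AEMeasurable μ (volume.restrict (Icc 0 1)) := by
  have (t : Icc (0 : ℝ) 1) : IsProbabilityMeasure (μ t) := hμ t t.2
  refine aemeasurable_restrict_of_measurable_subtype measurableSet_Icc
    (measurable_of_forall_measurable_integral fun φ hφ hφ_supp => ?_)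
  exact (continuousOn_iff_continuous_domRestrict.1
    (hv.continuousOn_integral (hφ.of_le (by simp)) hφ_supp)).measurable

end MeasurabilityOfFunctionals

section Variation

variable {d : ℕ} {p q α β V₀ : ℝ} {K : ℝ≥0} {τ : Measure ℝ} {Ω : Set (EucSp d)}
  {μ : ℝ → Measure (EucSp d)} {v ξ : ℝ → EucSp d → EucSp d} {t : ℝ}

theorem absolutelyContinuous_of_Lq_lt_top {ν : Measure (EucSp d)} (hν : Lq q ν < ⊤) :
    ν ≪ volume := by
  contrapose! hν
  simp [Lq, hν]

theorem setIntegral_pressureDensity [SigmaFinite (μ t)] (hq : 0 < q) (hΩ : MeasurableSet Ω)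
    (hμ : μ t ≪ volume) (hμΩ : μ t Ωᶜ = 0) :
    ∫ x in Ω, pressureDensity q μ ξ t x = ∫ x, pressureDensity q μ ξ t x := by
  refine setIntegral_eq_integral_of_ae_compl_eq_zero ?_
  have hzero : ∫⁻ x in Ωᶜ, (μ t).rnDeriv volume x = 0 := by
    rw [Measure.setLIntegral_rnDeriv hμ, hμΩ]
  rw [lintegral_eq_zero_iff (Measure.measurable_rnDeriv _ _)] at hzero
  filter_upwards [(ae_restrict_iff' hΩ.compl).1 hzero] with x hx hxΩ
  simp [pressureDensity, hx hxΩ, hq.ne']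

theorem hasRelBoundedDeriv_Lq (hq : 0 < q) (hΩ : MeasurableSet Ω) (hμ : AEMeasurable μ τ)
    (hprob : ∀ᵐ t ∂τ, IsProbabilityMeasure (μ t)) (hμΩ : ∀ᵐ t ∂τ, μ t Ωᶜ = 0)
    (hfin : ∀ᵐ t ∂τ, Lq q (μ t) < ⊤) (hξ : Differentiable ℝ (Function.uncurry ξ))
    (hK : LipschitzWith K (Function.uncurry ξ)) :
    HasRelBoundedDeriv τ (fun ε t => (Lq q (pushCurve (perturb ξ ε) μ t)).toReal)
      fun t => (1 - q) * ∫ x in Ω, pressureDensity q μ ξ t x where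
  aemeasurable := .of_forall fun ε => by
    have hT := (continuous_perturb hξ.continuous ε).measurable
    refine (aemeasurable_Lq (aemeasurable_map hμ hprob hT) ?_).ennreal_toReal
    filter_upwards [hprob] with t _
    exact Measure.isProbabilityMeasure_map (hT.comp measurable_prodMk_left).aemeasurable
  pos := by
    filter_upwards [hprob, hfin] with t _ ht
    rw [pushCurve_perturb_zero]
    exact ENNReal.toReal_pos (Lq_pos hq (IsProbabilityMeasure.ne_zero _)).ne' ht.ne
  isBigO := by
    obtain ⟨C, hC⟩ := exists_abs_toReal_Lq_map_sub_le hq.le d K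
    refine .of_bound C ?_
    filter_upwards [hC.prod_inl (ae τ), (hprob.and hfin).prod_inr (𝓝 0)] with ⟨ε, t⟩ hε ⟨_, ht⟩
    rw [pushCurve_perturb_zero, norm_mul, Real.norm_of_nonneg ENNReal.toReal_nonneg, mul_comm ‖ε‖,
      ← mul_assoc]
    exact hε (ξ t) (lipschitzWith_slice hK t) (differentiable_slice hξ t) (μ t)
      (absolutelyContinuous_of_Lq_lt_top ht) ht
  hasDerivAt := by
    filter_upwards [hprob, hμΩ, hfin] with t _ htΩ ht
    have hac := absolutelyContinuous_of_Lq_lt_top ht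
    rw [setIntegral_pressureDensity hq hΩ hac htΩ]
    exact hasDerivAt_toReal_Lq_map hq.le (lipschitzWith_slice hK t) (differentiable_slice hξ t)
      hac ht

theorem toReal_kinetic_lagrangianField_perturb (hp : 0 ≤ p)
    (hξ : Differentiable ℝ (Function.uncurry ξ)) (hv : AEStronglyMeasurable (v t) (μ t))
    (hL : AEStronglyMeasurable (lagrangianField ξ v t) (μ t)) (ε : ℝ) :
    (kinetic p μ (lagrangianField (perturb ξ ε) v) t).toReal =
      ∫ x, ‖v t x + ε • lagrangianField ξ v t x‖ ^ p ∂μ t := by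
  have hperturb : lagrangianField (perturb ξ ε) v t = v t + ε • lagrangianField ξ v t :=
    funext (lagrangianField_perturb hξ ε t)
  rw [toReal_kinetic_eq_integral hp (hperturb ▸ hv.add (hL.const_smul ε)), hperturb]
  rfl

theorem memLp_lagrangianField [IsFiniteMeasure (μ t)] {r : ℝ≥0∞} (hv : MemLp (v t) r (μ t))
    (hL : AEStronglyMeasurable (lagrangianField ξ v t) (μ t))
    (hK : LipschitzWith K (Function.uncurry ξ)) : MemLp (lagrangianField ξ v t) r (μ t) := by
  refine (hv.norm.add (memLp_const (1 : ℝ))).of_le_mul (c := K) hL (ae_of_all _ fun x => ?_)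
  rw [Pi.add_apply, Real.norm_of_nonneg (by positivity)]
  exact norm_lagrangianField_le hK t x

theorem integrable_kineticDensity [IsFiniteMeasure (μ t)] (hp : 1 < p)
    (hv : MemLp (v t) (ENNReal.ofReal p) (μ t))
    (hL : AEStronglyMeasurable (lagrangianField ξ v t) (μ t))
    (hK : LipschitzWith K (Function.uncurry ξ)) : Integrable (kineticDensity p v ξ t) (μ t) :=
  (hasDerivAt_integral_norm_add_smul_rpow hp hv (memLp_lagrangianField hv hL hK)).1

theorem abs_toReal_kinetic_lagrangianField_perturb_sub_le [IsProbabilityMeasure (μ t)] (hp : 1 ≤ p)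
    (hv : MemLp (v t) (ENNReal.ofReal p) (μ t))
    (hL : AEStronglyMeasurable (lagrangianField ξ v t) (μ t)) (hV₀ : 0 < V₀)
    (hV : ENNReal.ofReal V₀ ≤ kinetic p μ v t) (hξ : Differentiable ℝ (Function.uncurry ξ))
    (hK : LipschitzWith K (Function.uncurry ξ)) {ε : ℝ} (hε : |ε| ≤ 1) :
    |(kinetic p μ (lagrangianField (perturb ξ ε) v) t).toReal - (kinetic p μ v t).toReal| ≤
      p * ((1 + K) ^ p * 2 ^ (p - 1) * (1 + V₀⁻¹)) * (kinetic p μ v t).toReal * |ε| := by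
  have hp₀ : 0 < p := one_pos.trans_le hp
  have hL' := memLp_lagrangianField hv hL hK
  have hV' : V₀ ≤ (kinetic p μ v t).toReal :=
    (ENNReal.ofReal_le_iff_le_toReal (kinetic_lt_top_of_memLp hp₀ hv).ne).1 hV
  have hone : 1 ≤ V₀⁻¹ * (kinetic p μ v t).toReal := by
    rwa [inv_mul_eq_div, one_le_div hV₀]
  have hdiff := abs_integral_norm_add_smul_rpow_sub_le hp hv hL' hε
  have hsum := integral_norm_add_norm_rpow_le hp K.coe_nonneg hv hL' (norm_lagrangianField_le hK t)
  rw [← toReal_kinetic_lagrangianField_perturb hp₀.le hξ hv.1 hL] at hdiff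
  rw [← toReal_kinetic_eq_integral hp₀.le hv.1] at hdiff hsum
  calc _ ≤ _ := hdiff
    _ ≤ p * ((1 + K) ^ p * 2 ^ (p - 1) * ((kinetic p μ v t).toReal +
          V₀⁻¹ * (kinetic p μ v t).toReal)) * |ε| := by
        gcongr
        exact hsum.trans (by gcongr; simpa using hone)
    _ = _ := by ring

theorem hasRelBoundedDeriv_kinetic (hp : 1 < p) (hμ : AEMeasurable μ τ)
    (hprob : ∀ᵐ t ∂τ, IsProbabilityMeasure (μ t)) (hv : IsAEMeasurableField τ μ v)
    (hLp : ∀ᵐ t ∂τ, MemLp (v t) (ENNReal.ofReal p) (μ t)) (hV₀ : 0 < V₀)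
    (hV : ∀ᵐ t ∂τ, ENNReal.ofReal V₀ ≤ kinetic p μ v t)
    (hξ : Differentiable ℝ (Function.uncurry ξ)) (hK : LipschitzWith K (Function.uncurry ξ)) :
    HasRelBoundedDeriv τ (fun ε t => (kinetic p μ (lagrangianField (perturb ξ ε) v) t).toReal)
      fun t => p * ∫ x, kineticDensity p v ξ t x ∂μ t where
  aemeasurable := .of_forall fun ε => ((hv.lagrangianField
    (continuous_perturb hξ.continuous ε)).aemeasurable_kinetic hμ hprob).ennreal_toReal
  pos := by
    filter_upwards [hLp, hV] with t ht htV
    rw [lagrangianField_perturb_zero hξ]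
    exact ENNReal.toReal_pos ((ENNReal.ofReal_pos.2 hV₀).trans_le htV).ne'
      (kinetic_lt_top_of_memLp (one_pos.trans hp) ht).ne
  isBigO := by
    have hsmall : ∀ᶠ ε : ℝ in 𝓝 0, |ε| ≤ 1 := by
      simpa [Metric.closedBall] using! Metric.closedBall_mem_nhds (0 : ℝ) one_pos
    refine .of_bound (p * ((1 + K) ^ p * 2 ^ (p - 1) * (1 + V₀⁻¹))) ?_
    filter_upwards [hsmall.prod_inl (ae τ), (hprob.and (hLp.and (hV.and
      (hv.lagrangianField hξ.continuous).ae_aestronglyMeasurable))).prod_inr (𝓝 0)]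
      with ⟨ε, t⟩ hε ⟨_, ht, htV, htL⟩
    rw [lagrangianField_perturb_zero hξ, norm_mul, Real.norm_of_nonneg ENNReal.toReal_nonneg,
      mul_comm ‖ε‖, ← mul_assoc]
    exact abs_toReal_kinetic_lagrangianField_perturb_sub_le hp.le ht htL hV₀ htV hξ hK hε
  hasDerivAt := by
    filter_upwards [hprob, hLp, (hv.lagrangianField hξ.continuous).ae_aestronglyMeasurable]
      with t _ ht htL
    simp_rw [toReal_kinetic_lagrangianField_perturb (one_pos.trans hp).le hξ ht.1 htL]
    exact (hasDerivAt_integral_norm_add_smul_rpow hp ht (memLp_lagrangianField ht htL hK)).2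

theorem eventually_modifiedEnergy_eq (hp : 1 ≤ p)
    (hprob : ∀ᵐ t ∂volume.restrict (Icc (0 : ℝ) 1), IsProbabilityMeasure (μ t))
    (hv : IsAEMeasurableField (volume.restrict (Icc 0 1)) μ v)
    (hLp : ∀ᵐ t ∂volume.restrict (Icc (0 : ℝ) 1), MemLp (v t) (ENNReal.ofReal p) (μ t))
    (hξ : Differentiable ℝ (Function.uncurry ξ)) (hK : LipschitzWith K (Function.uncurry ξ)) :
    ∀ᶠ ε in 𝓝 0, modifiedEnergy p q α β μ v ξ ε = ∫⁻ t in Icc (0 : ℝ) 1,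
      Lq q (pushCurve (perturb ξ ε) μ t) ^ α *
        kinetic p μ (lagrangianField (perturb ξ ε) v) t ^ β := by
  filter_upwards [eventually_abs_mul_lt_one K] with ε hε
  refine lintegral_congr_ae ?_
  filter_upwards [hprob, hLp, (hv.lagrangianField hξ.continuous).ae_aestronglyMeasurable]
    with t _ ht htL
  obtain ⟨e, he⟩ := exists_homeomorph_id_add_smul (lipschitzWith_slice hK t) hε
  have hint : Integrable (lagrangianField (perturb ξ ε) v t) (μ t) := by
    rw [funext (lagrangianField_perturb hξ ε t)]
    have hp' : 1 ≤ ENNReal.ofReal p := ENNReal.one_le_ofReal.2 hp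
    exact (ht.integrable hp').add (((memLp_lagrangianField ht htL hK).integrable hp').smul ε)
  rw [kinetic_transportedField he.symm hint]

theorem ae_Lq_lt_top (hα : 0 < α) (hμ : AEMeasurable μ τ)
    (hprob : ∀ᵐ t ∂τ, IsProbabilityMeasure (μ t)) (hv : IsAEMeasurableField τ μ v)
    (hfin : ∫⁻ t, Lq q (μ t) ^ α * kinetic p μ v t ^ β ∂τ < ⊤)
    (hkin_pos : ∀ᵐ t ∂τ, 0 < kinetic p μ v t) (hkin_lt_top : ∀ᵐ t ∂τ, kinetic p μ v t < ⊤) :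
    ∀ᵐ t ∂τ, Lq q (μ t) < ⊤ := by
  filter_upwards [ae_lt_top' (((aemeasurable_Lq hμ hprob).pow_const α).mul
    ((hv.aemeasurable_kinetic hμ hprob).pow_const β)) hfin.ne, hkin_pos, hkin_lt_top]
    with t ht hpos hlt
  contrapose! ht
  have hkin : kinetic p μ v t ^ β ≠ 0 := (ENNReal.rpow_pos hpos hlt.ne).ne'
  rw [Pi.mul_apply, top_le_iff.1 ht, ENNReal.top_rpow_of_pos hα, ENNReal.top_mul hkin]

end Variation

end WeightedGeodesic

open WeightedGeodesic in
theorem mainTheorem3_general {d : ℕ} {Ω : Set (EucSp d)} (hΩ : MeasurableSet Ω) {p q α β : ℝ}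
    (hp : 1 < p) (hq : 0 < q) (hq₁ : q ≠ 1) (hα : 0 < α) {μ : ℝ → Measure (EucSp d)}
    (hμ : AEMeasurable μ (volume.restrict (Icc (0 : ℝ) 1)))
    (hprob : ∀ᵐ t ∂volume.restrict (Icc (0 : ℝ) 1), IsProbabilityMeasure (μ t))
    (hμΩ : ∀ᵐ t ∂volume.restrict (Icc (0 : ℝ) 1), μ t Ωᶜ = 0)
    {v : ℝ → EucSp d → EucSp d} (hv : IsAEMeasurableField (volume.restrict (Icc (0 : ℝ) 1)) μ v)
    (hLp : ∀ᵐ t ∂volume.restrict (Icc (0 : ℝ) 1), MemLp (v t) (ENNReal.ofReal p) (μ t))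
    (hfin : energy p q α β μ v < ⊤) {V₀ : ℝ} (hV₀ : 0 < V₀)
    (hV : ∀ᵐ t ∂volume.restrict (Icc (0 : ℝ) 1), ENNReal.ofReal V₀ ≤ kinetic p μ v t)
    {ξ : ℝ → EucSp d → EucSp d} (hξ : Differentiable ℝ (Function.uncurry ξ)) {K : ℝ≥0}
    (hK : LipschitzWith K (Function.uncurry ξ)) :
    (∀ᵐ t ∂volume.restrict (Icc (0 : ℝ) 1),
      μ t ≪ volume ∧ Lq q (μ t) < ⊤ ∧ kinetic p μ v t < ⊤ ∧
      IntegrableOn (pressureDensity q μ ξ t) Ω ∧ Integrable (kineticDensity p v ξ t) (μ t)) ∧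
    IntervalIntegrable (fun t => (Lq q (μ t)).toReal ^ (α - 1) * (kinetic p μ v t).toReal ^ β *
      ∫ x in Ω, pressureDensity q μ ξ t x) volume 0 1 ∧
    IntervalIntegrable (fun t => (Lq q (μ t)).toReal ^ α * (kinetic p μ v t).toReal ^ (β - 1) *
      ∫ x, kineticDensity p v ξ t x ∂μ t) volume 0 1 ∧
    (∀ᶠ ε in 𝓝 (0 : ℝ), modifiedEnergy p q α β μ v ξ ε < ⊤) ∧
    HasDerivAt (fun ε : ℝ => (modifiedEnergy p q α β μ v ξ ε).toReal)
      (α * (1 - q) * (∫ t in (0 : ℝ)..1, (Lq q (μ t)).toReal ^ (α - 1) *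
          (kinetic p μ v t).toReal ^ β * ∫ x in Ω, pressureDensity q μ ξ t x) +
        p * β * (∫ t in (0 : ℝ)..1, (Lq q (μ t)).toReal ^ α *
          (kinetic p μ v t).toReal ^ (β - 1) * ∫ x, kineticDensity p v ξ t x ∂μ t)) 0 := by
  have hkin : ∀ᵐ t ∂volume.restrict (Icc (0 : ℝ) 1), kinetic p μ v t < ⊤ :=
    hLp.mono fun t ht => kinetic_lt_top_of_memLp (one_pos.trans hp) ht
  have hLq := ae_Lq_lt_top hα hμ hprob hv hfin
    (hV.mono fun t ht => (ENNReal.ofReal_pos.2 hV₀).trans_le ht) hkin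
  have hF := hasRelBoundedDeriv_Lq hq hΩ hμ hprob hμΩ hLq hξ hK
  have hE := hasRelBoundedDeriv_kinetic hp hμ hprob hv hLp hV₀ hV hξ hK
  have hfin₀ : ∫⁻ t in Icc (0 : ℝ) 1, Lq q (pushCurve (perturb ξ 0) μ t) ^ α *
      kinetic p μ (lagrangianField (perturb ξ 0) v) t ^ β < ⊤ := by
    rwa [pushCurve_perturb_zero, lagrangianField_perturb_zero hξ]
  have hq₁' : 1 - q ≠ 0 := sub_ne_zero.2 hq₁.symm
  have hp₀ : p ≠ 0 := (one_pos.trans hp).ne'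
  have hint := hF.integrable_toReal_rpow_mul_rpow_sub_one hq₁' hp₀ hE hfin₀
  have hderiv := hF.hasDerivAt_toReal_lintegral_rpow_mul_rpow hq₁' hp₀ hE hfin₀
  have heq := eventually_modifiedEnergy_eq (q := q) (α := α) (β := β) hp.le hprob hv hLp hξ hK
  simp only [pushCurve_perturb_zero, lagrangianField_perturb_zero hξ, integral_Icc_eq_integral_Ioc,
    ← intervalIntegral.integral_of_le (zero_le_one' ℝ)] at hint hderiv
  refine ⟨?_, (intervalIntegrable_iff_integrableOn_Icc_of_le zero_le_one).2 hint.1,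
    (intervalIntegrable_iff_integrableOn_Icc_of_le zero_le_one).2 hint.2, ?_,
    hderiv.congr_of_eventuallyEq (heq.mono fun ε hε => congrArg ENNReal.toReal hε)⟩
  · filter_upwards [hprob, hLq, hkin, hLp,
      (hv.lagrangianField hξ.continuous).ae_aestronglyMeasurable] with t _ htF htV ht htL
    have hac := absolutelyContinuous_of_Lq_lt_top htF
    exact ⟨hac, htF, htV, (integrable_divergence_mul_rnDeriv_rpow (lipschitzWith_slice hK t) hac
      htF).integrableOn, integrable_kineticDensity hp ht htL hK⟩
  · filter_upwards [heq, (hF.toReal_rpow_mul_rpow hE).eventually_lintegral_eq hfin₀] with ε hε hε'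
    rw [hε, hε']
    exact ENNReal.ofReal_lt_top

theorem mainTheorem3 {d : ℕ} (Ω : Set (EucSp d)) (hΩ_closed : IsClosed Ω) (hΩ_convex : Convex ℝ Ω)
    (p q α β : ℝ) (hp : 1 < p) (hq : 1 < q) (hα : 0 < α)
    (μ : ℝ → Measure (EucSp d)) (hμ : WeightedGeodesic.IsLipschitzCurve p Ω μ)
    (v : ℝ → EucSp d → EucSp d) (hv : WeightedGeodesic.IsTangentField p Ω μ v)
    (hfin : WeightedGeodesic.energy p q α β μ v < ⊤)
    (V₀ : ℝ) (hV₀ : 0 < V₀)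
    (hV : ∀ᵐ t ∂volume.restrict (Icc (0 : ℝ) 1),
      ENNReal.ofReal V₀ ≤ WeightedGeodesic.kinetic p μ v t)
    (ξ : ℝ → EucSp d → EucSp d) (hξ : ContDiff ℝ ∞ (Function.uncurry ξ))
    (hξ_supp : HasCompactSupport (Function.uncurry ξ)) :
    (∀ᵐ t ∂volume.restrict (Icc (0 : ℝ) 1),
      μ t ≪ volume ∧ WeightedGeodesic.Lq q (μ t) < ⊤ ∧ WeightedGeodesic.kinetic p μ v t < ⊤ ∧
      IntegrableOn (WeightedGeodesic.pressureDensity q μ ξ t) Ω ∧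
      Integrable (WeightedGeodesic.kineticDensity p v ξ t) (μ t)) ∧
    IntervalIntegrable (fun t =>
      (WeightedGeodesic.Lq q (μ t)).toReal ^ (α - 1) *
        (WeightedGeodesic.kinetic p μ v t).toReal ^ β *
          ∫ x in Ω, WeightedGeodesic.pressureDensity q μ ξ t x) volume 0 1 ∧
    IntervalIntegrable (fun t =>
      (WeightedGeodesic.Lq q (μ t)).toReal ^ α *
        (WeightedGeodesic.kinetic p μ v t).toReal ^ (β - 1) *
          ∫ x, WeightedGeodesic.kineticDensity p v ξ t x ∂μ t) volume 0 1 ∧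
    (∀ᶠ ε in 𝓝 (0 : ℝ), WeightedGeodesic.modifiedEnergy p q α β μ v ξ ε < ⊤) ∧
    HasDerivAt (fun ε : ℝ => (WeightedGeodesic.modifiedEnergy p q α β μ v ξ ε).toReal)
      (α * (1 - q) * (∫ t in (0 : ℝ)..1,
          (WeightedGeodesic.Lq q (μ t)).toReal ^ (α - 1) *
            (WeightedGeodesic.kinetic p μ v t).toReal ^ β *
              ∫ x in Ω, WeightedGeodesic.pressureDensity q μ ξ t x) +
        p * β * (∫ t in (0 : ℝ)..1,
          (WeightedGeodesic.Lq q (μ t)).toReal ^ α *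
            (WeightedGeodesic.kinetic p μ v t).toReal ^ (β - 1) *
              ∫ x, WeightedGeodesic.kineticDensity p v ξ t x ∂μ t)) 0 := by
  obtain ⟨K, hK⟩ := hξ.lipschitzWith_of_hasCompactSupport hξ_supp (by simp)
  have hprob : ∀ t ∈ Icc (0 : ℝ) 1, IsProbabilityMeasure (μ t) :=
    fun t ht => (hμ.mem t ht).isProbabilityMeasure
  have hμΩ : ∀ᵐ t ∂volume.restrict (Icc (0 : ℝ) 1), μ t Ωᶜ = 0 :=
    ae_restrict_of_forall_mem measurableSet_Icc fun t ht => (hμ.mem t ht).compl_eq_zero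
  exact mainTheorem3_general hΩ_closed.measurableSet hp (one_pos.trans hq) hq.ne' hα
    (hv.isVelocityField.aemeasurable hprob) (ae_restrict_of_forall_mem measurableSet_Icc hprob) hμΩ
    (WeightedGeodesic.isAEMeasurableField_of_measurable_domRestrict hΩ_closed.measurableSet
      hv.isVelocityField.measurable hμΩ)
    hv.isVelocityField.memLp hfin hV₀ hV (hξ.differentiable (by simp)) hK
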